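/- Let $Y$ and $Y_n$ ($n\in\mathbb N$) be random variables on a probability space $(\Omega,\mathcal A,\mathbb P)$ with values in a measurable space $(E,\mathcal F)$, let $\mathbb P_Y$ be the law of $Y$ and $\mathbb E_Y$ the expectation under $\mathbb P_Y$. Let $\mathcal D$ be an algebra of bounded measurable functions on $E$, real-valued or complex-valued (and then stable under complex conjugation), which contains the constants and is dense in $L^2(\mathbb P_Y)$, and let $(\alpha_n)$ be a sequence of positive numbers. Assume (H3) for every $\varphi\in\mathcal D$ there is $\widetilde A[\varphi]\in L^2(\mathbb P_Y)$ such that for all $\chi\in\mathcal D$ $$\lim_{n}\alpha_n\,\mathbb E\big[(\varphi(Y_n)-\varphi(Y))(\chi(Y_n)-\chi(Y))\big]=-2\,\mathbb E_Y\big[\widetilde A[\varphi]\,\chi\big].$$ Let $(\mathcal E,\mathbb D)$ be the smallest closed extension in the real space $L^2(\mathbb P_Y)$ of the form $$\widetilde{\mathcal E}[\varphi,\chi]=\lim_n\frac{\alpha_n}{2}\,\mathbb E\big[(\varphi(Y_n)-\varphi(Y))(\chi(Y_n)-\chi(Y))\big]$$ on the real-valued functions of $\mathcal D$, and suppose that $\mathcal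 E$ is local, i.e. $\mathcal E[G(u),H(u)]=0$ for all $u\in\mathbb D$ and all $G,H\in C_c^\infty(\mathbb R)$ with disjoint supports. Then for real-valued $f,g\in\mathcal D$ the square field $\Gamma[f,g]\in L^1(\mathbb P_Y)$ of $\mathcal E$ exists, characterized by $$\mathcal E[fh,g]+\mathcal E[gh,f]-\mathcal E[h,fg]=\mathbb E_Y\big[h\,\Gamma[f,g]\big]\qquad\text{for all }h\in\mathbb D\cap L^\infty(\mathbb P_Y),$$ and for all $p\in\mathbb N$, $F\in C^1(\mathbb R^p,\mathbb R)$ and real-valued $f_1,\dots,f_p\in\mathcal D$ $$\lim_n\alpha_n\,\mathbb E\big[\big(F(f_1(Y_n),\dots,f_p(Y_n))-F(f_1(Y),\dots,f_p(Y))\big)^2\big]=\mathbb E_Y\Big[\sum_{i,j=1}^pF'_i(f_1,\dots,f_p)\,F'_j(f_1,\dots,f_p)\,\Gamma[f_i,f_j]\Big].$$ -/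

import Mathlib

open MeasureTheory Filter Topology
open scoped ENNReal ContDiff

noncomputable section

/-- The real-valued members of an algebra of `𝕜`-valued functions, seen as functions into `ℝ`.
For `𝕜 = ℝ` this is the whole algebra. -/
def realMembers {E 𝕜 : Type*} [RCLike 𝕜] (D : StarSubalgebra 𝕜 (E → 𝕜)) : Set (E → ℝ) :=
  {f | (fun x => (f x : 𝕜)) ∈ D}

/-- `D` is an algebra of bounded measurable functions that is dense in `L²(μ; 𝕜)`.
(A `StarSubalgebra` contains the constants and is stable under complex conjugation;
for `𝕜 = ℝ` it is just a unital subalgebra.) -/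
structure IsBoundedDenseAlgebra {E 𝕜 : Type*} [MeasurableSpace E] [RCLike 𝕜]
    (μ : Measure E) (D : StarSubalgebra 𝕜 (E → 𝕜)) : Prop where
  measurable : ∀ φ ∈ D, Measurable φ
  bounded : ∀ φ ∈ D, ∃ C : ℝ, ∀ x, ‖φ x‖ ≤ C
  dense : ∀ g : E → 𝕜, MemLp g 2 μ → ∀ ε : ℝ≥0∞, 0 < ε → ∃ φ ∈ D, eLpNorm (g - φ) 2 μ < ε

/-- Hypothesis (H3): every `φ ∈ D` has a symmetric bias `Aφ ∈ L²(P_Y)` such that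
`α_n E[(φ(Y_n) - φ(Y)) (χ(Y_n) - χ(Y))] → -2 E_Y[Aφ χ]` for all `χ ∈ D`. -/
def HypothesisH3 {Ω E 𝕜 : Type*} [MeasurableSpace Ω] [MeasurableSpace E] [RCLike 𝕜]
    (P : Measure Ω) (Y : Ω → E) (Yn : ℕ → Ω → E) (α : ℕ → ℝ)
    (D : StarSubalgebra 𝕜 (E → 𝕜)) : Prop :=
  ∀ φ ∈ D, ∃ Aφ : E → 𝕜, MemLp Aφ 2 (P.map Y) ∧ ∀ χ ∈ D,
    Tendsto
      (fun n => (α n : 𝕜) * ∫ s, (φ (Yn n s) - φ (Y s)) * (χ (Yn n s) - χ (Y s)) ∂P)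
      atTop (𝓝 (-2 * ∫ x, Aφ x * χ x ∂(P.map Y)))

/-! ### Smallest closed extension of a form

`q` is a bilinear form given on a space `𝒟` of functions.  Elements of `L²(μ)` are represented by
functions; for a closable form all notions below depend on `μ`-almost everywhere classes only. -/

section Closure

variable {E : Type*} [MeasurableSpace E]

/-- `φ` is a `q`-Cauchy sequence in `𝒟` that converges to `u` in `L²(μ)`. -/
structure IsApproximatingSeq (μ : Measure E) (𝒟 : Set (E → ℝ))
    (q : (E → ℝ) → (E → ℝ) → ℝ) (φ : ℕ → E → ℝ) (u : E → ℝ) : Prop where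
  mem : ∀ k, φ k ∈ 𝒟
  tendsto : Tendsto (fun k => eLpNorm (φ k - u) 2 μ) atTop (𝓝 0)
  cauchy : ∀ ε : ℝ, 0 < ε → ∃ N, ∀ j ≥ N, ∀ k ≥ N, q (φ j - φ k) (φ j - φ k) < ε

/-- The domain of the smallest closed extension of `(q, 𝒟)`. -/
def closureDomain (μ : Measure E) (𝒟 : Set (E → ℝ)) (q : (E → ℝ) → (E → ℝ) → ℝ) :
    Set (E → ℝ) :=
  {u | MemLp u 2 μ ∧ ∃ φ, IsApproximatingSeq μ 𝒟 q φ u}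

open Classical in
/-- The smallest closed extension of `(q, 𝒟)`: its value at `(u, v)` is `lim_k q(φ_k, χ_k)` for
approximating sequences `φ` of `u` and `χ` of `v`.  (When the form is closable, the limit exists
and does not depend on the sequences.) -/
def closureForm (μ : Measure E) (𝒟 : Set (E → ℝ)) (q : (E → ℝ) → (E → ℝ) → ℝ)
    (u v : E → ℝ) : ℝ :=
  if h : u ∈ closureDomain μ 𝒟 q ∧ v ∈ closureDomain μ 𝒟 q then
    limUnder atTop (fun k => q (h.1.2.choose k) (h.2.2.choose k))
  else 0

/-- Locality of a form `(ℰ, 𝔻)`: `ℰ[F(u), G(u)] = 0` for all `u ∈ 𝔻` and all smooth compactly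
supported `F`, `G` with disjoint supports.  (It is used for forms whose domain contains the
constants and for which constants have zero energy, so that `F`, `G` need not be normalized
at `0`.) -/
def IsLocalForm (𝔻 : Set (E → ℝ)) (ℰ : (E → ℝ) → (E → ℝ) → ℝ) : Prop :=
  ∀ u ∈ 𝔻, ∀ F G : ℝ → ℝ, ContDiff ℝ ∞ F → ContDiff ℝ ∞ G →
    HasCompactSupport F → HasCompactSupport G → Disjoint (tsupport F) (tsupport G) →
    ℰ (F ∘ u) (G ∘ u) = 0

/-- `γ` is (a version of) the value `Γ[u, v]` of the square field operator of `(ℰ, 𝔻)` at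
`u, v ∈ 𝔻 ∩ L^∞`: `γ ∈ L¹(μ)` and
`ℰ[u w, v] + ℰ[v w, u] - ℰ[w, u v] = ∫ w γ dμ` for all `w ∈ 𝔻 ∩ L^∞`. -/
def IsSquareField (μ : Measure E) (𝔻 : Set (E → ℝ)) (ℰ : (E → ℝ) → (E → ℝ) → ℝ)
    (u v γ : E → ℝ) : Prop :=
  Integrable γ μ ∧ ∀ w ∈ 𝔻, MemLp w ∞ μ →
    ℰ (u * w) v + ℰ (v * w) u - ℰ w (u * v) = ∫ x, w x * γ x ∂μ

end Closure

/-! ### The limit form of an approximation -/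

section Limit

variable {Ω E : Type*} [MeasurableSpace Ω] [MeasurableSpace E]

/-- `lim_n (α_n / 2) E[(φ(Y_n) - φ(Y)) (χ(Y_n) - χ(Y))]` (the limit exists under (H3) when
`φ, χ` are members of the algebra). -/
def preLimitForm (P : Measure Ω) (Y : Ω → E) (Yn : ℕ → Ω → E) (α : ℕ → ℝ)
    (φ χ : E → ℝ) : ℝ :=
  limUnder atTop
    (fun n => α n / 2 * ∫ s, (φ (Yn n s) - φ (Y s)) * (χ (Yn n s) - χ (Y s)) ∂P)

/-- The domain `𝔻` of the limit Dirichlet form. -/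
def limitDomain {𝕜 : Type*} [RCLike 𝕜] (P : Measure Ω) (Y : Ω → E) (Yn : ℕ → Ω → E)
    (α : ℕ → ℝ) (D : StarSubalgebra 𝕜 (E → 𝕜)) : Set (E → ℝ) :=
  closureDomain (P.map Y) (realMembers D) (preLimitForm P Y Yn α)

/-- The limit Dirichlet form `ℰ`. -/
def limitForm {𝕜 : Type*} [RCLike 𝕜] (P : Measure Ω) (Y : Ω → E) (Yn : ℕ → Ω → E)
    (α : ℕ → ℝ) (D : StarSubalgebra 𝕜 (E → 𝕜)) (u v : E → ℝ) : ℝ :=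
  closureForm (P.map Y) (realMembers D) (preLimitForm P Y Yn α) u v

end Limit

end

/-! Write Δφ = φ(Y_n) - φ(Y). By (H3) the limit form on the real members of the algebra is q(φ, χ) =
-∫ Aφ χ with Aφ ∈ L², so q(φ, ·) is L²-continuous. Hence q is closable (`tendsto_self_zero`), and
ℰ[u, φ] = -∫ Aφ u for u in the closed domain and φ in the algebra (`closureForm_eq_neg_integral`).
This forces Γ[f, g] = A(fg) - f Ag - g Af. It is a square field once fh stays in the domain for
bounded h in the domain (`mul_mem_closureDomain`).

For the limit, the identity Δg Δ(fh) + Δf Δ(gh) - Δ(fg) Δh = (h(Y) + h(Y_n)) Δf Δg and (H3) yield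
the limit of α_n E[½(h(Y) + h(Y_n)) Δf Δg], namely ∫ h Γ[f, g] (`tendsto_symmetrized`). Replacing
the symmetric weight by h(Y) costs a third order term, which vanishes because locality implies α_n
E[(Δf)⁴] → 0 (`tendsto_fourth_moment`). Indeed, for bumps G, K with disjoint supports the form at (G
∘ f, K ∘ f) dominates the probability that f jumps from one region to the other, and its limit is
ℰ[G ∘ f, K ∘ f] = 0. By compactness α_n P(|Δf| ≥ δ) → 0, and the small jumps satisfy (Δf)⁴ ≤ δ²
(Δf)².

Stone–Weierstrass extends the weights to continuous functions of members of the algebra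
(`tendsto_weighted_continuous`). A first order Taylor expansion of F then concludes: the square of
its linear part has the announced limit, and its remainder is controlled by second and fourth
moments. -/

noncomputable section

set_option linter.unusedSectionVars false

/-! ### Closability and closure of forms represented by an L²-valued operator. -/

/-- A symmetric nonnegative form `q` on a space `S` of square integrable functions that is
represented by an operator `A` with values in `L²(μ)`: `q φ χ = -∫ A φ * χ`. -/
structure IsRepresentedForm {E : Type*} [MeasurableSpace E] (μ : Measure E)
    (S : Submodule ℝ (E → ℝ)) (q : (E → ℝ) → (E → ℝ) → ℝ) (A : (E → ℝ) → E → ℝ) : Prop where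
  memLp : ∀ φ ∈ S, MemLp φ 2 μ
  memLp_gen : ∀ φ ∈ S, MemLp (A φ) 2 μ
  eq_neg_integral : ∀ φ ∈ S, ∀ χ ∈ S, q φ χ = -∫ x, A φ x * χ x ∂μ
  symm : ∀ φ ∈ S, ∀ χ ∈ S, q φ χ = q χ φ
  nonneg : ∀ φ ∈ S, 0 ≤ q φ φ

section L2

variable {E : Type*} [MeasurableSpace E] {μ : Measure E}

lemma tendsto_integral_mul_of_tendsto_eLpNorm {a u : E → ℝ} {φ : ℕ → E → ℝ}
    (ha : MemLp a 2 μ) (hφ : ∀ k, MemLp (φ k) 2 μ) (hu : MemLp u 2 μ)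
    (h : Tendsto (fun k => eLpNorm (φ k - u) 2 μ) atTop (𝓝 0)) :
    Tendsto (fun k => ∫ x, a x * φ k x ∂μ) atTop (𝓝 (∫ x, a x * u x ∂μ)) := by
  have hint : ∀ v : E → ℝ, MemLp v 2 μ → Integrable (fun x => a x * v x) μ :=
    fun v hv => ha.integrable_mul hv
  have hlim : Tendsto (fun k => eLpNorm a 2 μ * eLpNorm (φ k - u) 2 μ) atTop (𝓝 0) := by
    have := ENNReal.Tendsto.const_mul (a := eLpNorm a 2 μ) h (Or.inr ha.2.ne)
    simpa using this
  refine tendsto_integral_of_L1' _ (hint u hu).aestronglyMeasurable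
    (Eventually.of_forall fun k => hint _ (hφ k)) ?_
  refine tendsto_of_tendsto_of_tendsto_of_le_of_le tendsto_const_nhds hlim
    (fun _ => zero_le) fun k => ?_
  have := eLpNorm_smul_le_mul_eLpNorm (p := 2) (q := 2) (r := 1) (μ := μ)
    ((hφ k).sub hu).aestronglyMeasurable ha.aestronglyMeasurable
  refine le_trans (le_of_eq ?_) this
  congr 1
  ext x
  simp [mul_sub]

end L2

namespace IsRepresentedForm

variable {E : Type*} [MeasurableSpace E] {μ : Measure E} {S : Submodule ℝ (E → ℝ)}
  {q : (E → ℝ) → (E → ℝ) → ℝ} {A : (E → ℝ) → E → ℝ} {φ χ ψ u v : E → ℝ}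

lemma add_right (h : IsRepresentedForm μ S q A) (hφ : φ ∈ S) (hχ : χ ∈ S) (hψ : ψ ∈ S) :
    q φ (χ + ψ) = q φ χ + q φ ψ := by
  rw [h.eq_neg_integral _ hφ _ (S.add_mem hχ hψ), h.eq_neg_integral _ hφ _ hχ,
    h.eq_neg_integral _ hφ _ hψ]
  have e := integral_add ((h.memLp_gen _ hφ).integrable_mul (h.memLp _ hχ))
    ((h.memLp_gen _ hφ).integrable_mul (h.memLp _ hψ))
  simp only [Pi.add_apply, Pi.mul_apply, mul_add] at e ⊢
  rw [e]; ring

lemma smul_right (h : IsRepresentedForm μ S q A) (hφ : φ ∈ S) (hχ : χ ∈ S) (c : ℝ) :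
    q φ (c • χ) = c * q φ χ := by
  rw [h.eq_neg_integral _ hφ _ (S.smul_mem c hχ), h.eq_neg_integral _ hφ _ hχ,
    ← neg_mul_comm, neg_mul, ← integral_const_mul]
  simp only [Pi.smul_apply, smul_eq_mul, mul_left_comm]

lemma sub_right (h : IsRepresentedForm μ S q A) (hφ : φ ∈ S) (hχ : χ ∈ S) (hψ : ψ ∈ S) :
    q φ (χ - ψ) = q φ χ - q φ ψ := by
  have := h.add_right hφ (S.sub_mem hχ hψ) hψ
  rw [sub_add_cancel] at this
  linarith

lemma sub_left (h : IsRepresentedForm μ S q A) (hφ : φ ∈ S) (hχ : χ ∈ S) (hψ : ψ ∈ S) :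
    q (φ - χ) ψ = q φ ψ - q χ ψ := by
  rw [h.symm _ (S.sub_mem hφ hχ) _ hψ, h.sub_right hψ hφ hχ, h.symm _ hψ _ hφ,
    h.symm _ hψ _ hχ]

lemma sub_self (h : IsRepresentedForm μ S q A) (hφ : φ ∈ S) (hχ : χ ∈ S) :
    q (φ - χ) (φ - χ) = q φ φ - 2 * q φ χ + q χ χ := by
  rw [h.sub_left hφ hχ (S.sub_mem hφ hχ), h.sub_right hφ hφ hχ, h.sub_right hχ hφ hχ,
    h.symm _ hχ _ hφ]
  ring

lemma add_self (h : IsRepresentedForm μ S q A) (hφ : φ ∈ S) (hχ : χ ∈ S) :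
    q (φ + χ) (φ + χ) = q φ φ + 2 * q φ χ + q χ χ := by
  have hs := S.add_mem hφ hχ
  rw [h.add_right hs hφ hχ, h.symm _ hs _ hφ, h.symm _ hs _ hχ, h.add_right hφ hφ hχ,
    h.add_right hχ hφ hχ, h.symm _ hχ _ hφ]
  ring

lemma smul_self (h : IsRepresentedForm μ S q A) (hφ : φ ∈ S) (c : ℝ) :
    q (c • φ) (c • φ) = c ^ 2 * q φ φ := by
  have hs := S.smul_mem c hφ
  rw [h.smul_right hs hφ, h.symm _ hs _ hφ, h.smul_right hφ hφ]
  ring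

lemma sq_le (h : IsRepresentedForm μ S q A) (hφ : φ ∈ S) (hχ : χ ∈ S) :
    q φ χ ^ 2 ≤ q φ φ * q χ χ := by
  have key : ∀ t : ℝ, 0 ≤ q χ χ * (t * t) + 2 * q φ χ * t + q φ φ := fun t => by
    have := h.nonneg _ (S.add_mem hφ (S.smul_mem t hχ))
    rw [h.add_self hφ (S.smul_mem t hχ), h.smul_self hχ, h.smul_right hφ hχ] at this
    linarith
  have := discrim_le_zero key
  rw [discrim] at this
  linarith

/-- Parallelogram law for φ - χ and χ, dropping the nonnegative energy of φ - 2χ. -/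
lemma le_two_mul_sub_add (h : IsRepresentedForm μ S q A) (hφ : φ ∈ S) (hχ : χ ∈ S) :
    q φ φ ≤ 2 * q (φ - χ) (φ - χ) + 2 * q χ χ := by
  have h1 := h.nonneg _ (S.sub_mem (S.sub_mem hφ hχ) hχ)
  have h2 := h.add_self (S.sub_mem hφ hχ) hχ
  rw [h.sub_self (S.sub_mem hφ hχ) hχ] at h1
  rw [sub_add_cancel] at h2
  linarith

lemma sub_sub_le (h : IsRepresentedForm μ S q A) (hφ : φ ∈ S) (hχ : χ ∈ S) :
    q (φ - χ) (φ - χ) ≤ 2 * q φ φ + 2 * q χ χ := by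
  have h1 := h.nonneg _ (S.add_mem hφ hχ)
  rw [h.add_self hφ hχ] at h1
  rw [h.sub_self hφ hχ]
  linarith

/-- This is the source of closability: since A φ ∈ L², the functional q(φ, ·) only sees L² limits.
-/
lemma tendsto_form_right {φ : E → ℝ} {χ : ℕ → E → ℝ} (h : IsRepresentedForm μ S q A)
    (hφ : φ ∈ S) (hu : MemLp u 2 μ) (hχ : IsApproximatingSeq μ S q χ u) :
    Tendsto (fun k => q φ (χ k)) atTop (𝓝 (-∫ x, A φ x * u x ∂μ)) := by
  simp_rw [fun k => h.eq_neg_integral _ hφ _ (hχ.mem k)]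
  exact (tendsto_integral_mul_of_tendsto_eLpNorm (h.memLp_gen _ hφ)
    (fun k => h.memLp _ (hχ.mem k)) hu hχ.tendsto).neg

lemma isApproximatingSeq_sub {φ χ : ℕ → E → ℝ} (h : IsRepresentedForm μ S q A)
    (hu : MemLp u 2 μ) (hφ : IsApproximatingSeq μ S q φ u) (hχ : IsApproximatingSeq μ S q χ u) :
    IsApproximatingSeq μ S q (fun k => φ k - χ k) 0 where
  mem k := S.sub_mem (hφ.mem k) (hχ.mem k)
  tendsto := by
    have := hφ.tendsto.add hχ.tendsto
    rw [add_zero] at this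
    refine tendsto_of_tendsto_of_tendsto_of_le_of_le tendsto_const_nhds this
      (fun _ => zero_le) fun k => ?_
    have := eLpNorm_sub_le ((h.memLp _ (hφ.mem k)).sub hu).aestronglyMeasurable
      ((h.memLp _ (hχ.mem k)).sub hu).aestronglyMeasurable (p := 2) (by norm_num)
    simpa using this
  cauchy ε hε := by
    obtain ⟨N, hN⟩ := hφ.cauchy (ε / 4) (by positivity)
    obtain ⟨N', hN'⟩ := hχ.cauchy (ε / 4) (by positivity)
    refine ⟨max N N', fun j hj k hk => ?_⟩
    have h1 := hN j (le_of_max_le_left hj) k (le_of_max_le_left hk)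
    have h2 := hN' j (le_of_max_le_right hj) k (le_of_max_le_right hk)
    have h3 := h.sub_sub_le (S.sub_mem (hφ.mem j) (hφ.mem k)) (S.sub_mem (hχ.mem j) (hχ.mem k))
    rw [show φ j - χ j - (φ k - χ k) = φ j - φ k - (χ j - χ k) by abel]
    linarith

/-- Closability: an approximating sequence of `0` has vanishing energy in the limit. -/
lemma tendsto_self_zero {φ : ℕ → E → ℝ} (h : IsRepresentedForm μ S q A)
    (hφ : IsApproximatingSeq μ S q φ 0) :
    Tendsto (fun k => q (φ k) (φ k)) atTop (𝓝 0) := by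
  rw [Metric.tendsto_atTop]
  intro ε hε
  obtain ⟨N, hN⟩ := hφ.cauchy (ε / 2) (by positivity)
  refine ⟨N, fun k hk => ?_⟩
  rw [Real.dist_eq, sub_zero, abs_of_nonneg (h.nonneg _ (hφ.mem k))]
  have hl := h.tendsto_form_right (hφ.mem k) (MemLp.zero) hφ
  -- For large j, q(φ_k - φ_j) < ε/2 and q(φ_j) ≥ 0 give q(φ_k) ≤ ε/2 + 2 q(φ_k, φ_j). As j → ∞ the
  -- cross term becomes an integral against the limit 0.
  have hle : q (φ k) (φ k) ≤ ε / 2 + 2 * (-∫ x, A (φ k) x * (0 : E → ℝ) x ∂μ) := by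
    refine ge_of_tendsto ((hl.const_mul 2).const_add (ε / 2)) ?_
    filter_upwards [eventually_ge_atTop N] with j hj
    have h1 := hN k hk j hj
    rw [h.sub_self (hφ.mem k) (hφ.mem j)] at h1
    have := h.nonneg _ (hφ.mem j)
    linarith
  simp at hle
  linarith

lemma exists_bound_self {φ : ℕ → E → ℝ} (h : IsRepresentedForm μ S q A)
    (hφ : IsApproximatingSeq μ S q φ u) :
    ∃ C, ∃ N, ∀ k ≥ N, q (φ k) (φ k) ≤ C := by
  obtain ⟨N, hN⟩ := hφ.cauchy 1 one_pos
  refine ⟨2 * 1 + 2 * q (φ N) (φ N), N, fun k hk => ?_⟩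
  have := h.le_two_mul_sub_add (hφ.mem k) (hφ.mem N)
  have := hN k hk N le_rfl
  linarith

lemma tendsto_zero_of_self {φ χ : ℕ → E → ℝ} {C : ℝ} (h : IsRepresentedForm μ S q A)
    (hφ : ∀ k, φ k ∈ S) (hχ : ∀ k, χ k ∈ S) (hb : ∀ᶠ k in atTop, q (χ k) (χ k) ≤ C)
    (h0 : Tendsto (fun k => q (φ k) (φ k)) atTop (𝓝 0)) :
    Tendsto (fun k => q (φ k) (χ k)) atTop (𝓝 0) := by
  have hsq : Tendsto (fun k => q (φ k) (χ k) ^ 2) atTop (𝓝 0) := by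
    have := h0.mul_const C
    rw [zero_mul] at this
    refine tendsto_of_tendsto_of_tendsto_of_le_of_le' tendsto_const_nhds this
      (Eventually.of_forall fun _ => sq_nonneg _) ?_
    filter_upwards [hb] with k hk
    exact (h.sq_le (hφ k) (hχ k)).trans (mul_le_mul_of_nonneg_left hk (h.nonneg _ (hφ k)))
  have := (Real.continuous_sqrt.tendsto 0).comp hsq
  simp only [Function.comp_def, Real.sqrt_sq_eq_abs, Real.sqrt_zero] at this
  exact (tendsto_zero_iff_abs_tendsto_zero _).2 this

lemma cauchySeq {φ χ : ℕ → E → ℝ} (h : IsRepresentedForm μ S q A)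
    (hφ : IsApproximatingSeq μ S q φ u) (hχ : IsApproximatingSeq μ S q χ v) :
    CauchySeq fun k => q (φ k) (χ k) := by
  obtain ⟨C, N, hC⟩ := h.exists_bound_self hφ
  obtain ⟨C', N', hC'⟩ := h.exists_bound_self hχ
  set B := max 1 (max C C') with hB
  have hB1 : 0 < B := lt_of_lt_of_le one_pos (le_max_left _ _)
  have aux : ∀ {φ χ : E → ℝ}, φ ∈ S → χ ∈ S → ∀ {ε : ℝ}, 0 < ε →
      q φ φ < (ε / 2) ^ 2 / B → q χ χ ≤ B → |q φ χ| < ε / 2 := by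
    intro φ χ hφ hχ ε hε h1 h2
    refine abs_lt_of_sq_lt_sq ?_ (by positivity)
    calc q φ χ ^ 2 ≤ q φ φ * q χ χ := h.sq_le hφ hχ
      _ ≤ q φ φ * B := mul_le_mul_of_nonneg_left h2 (h.nonneg _ hφ)
      _ < (ε / 2) ^ 2 / B * B := mul_lt_mul_of_pos_right h1 hB1
      _ = (ε / 2) ^ 2 := div_mul_cancel₀ _ hB1.ne'
  rw [Metric.cauchySeq_iff]
  intro ε hε
  obtain ⟨M, hM⟩ := hφ.cauchy ((ε / 2) ^ 2 / B) (by positivity)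
  obtain ⟨M', hM'⟩ := hχ.cauchy ((ε / 2) ^ 2 / B) (by positivity)
  refine ⟨max (max N N') (max M M'), fun j hj k hk => ?_⟩
  simp only [ge_iff_le, max_le_iff] at hj hk
  have h1 := aux (S.sub_mem (hφ.mem j) (hφ.mem k)) (hχ.mem j) hε
    (hM j hj.2.1 k hk.2.1) ((hC' j hj.1.2).trans ((le_max_right _ _).trans (le_max_right _ _)))
  have h2 := aux (S.sub_mem (hχ.mem j) (hχ.mem k)) (hφ.mem k) hε
    (hM' j hj.2.2 k hk.2.2) ((hC k hk.1.1).trans ((le_max_left _ _).trans (le_max_right _ _)))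
  rw [h.sub_left (hφ.mem j) (hφ.mem k) (hχ.mem j)] at h1
  rw [h.symm _ (S.sub_mem (hχ.mem j) (hχ.mem k)) _ (hφ.mem k),
    h.sub_right (hφ.mem k) (hχ.mem j) (hχ.mem k)] at h2
  rw [Real.dist_eq]
  calc |q (φ j) (χ j) - q (φ k) (χ k)|
      = |(q (φ j) (χ j) - q (φ k) (χ j)) + (q (φ k) (χ j) - q (φ k) (χ k))| := by ring_nf
    _ ≤ _ := abs_add_le _ _
    _ < ε := by linarith

/-- The closure of a represented form can be computed along arbitrary approximating sequences. -/
lemma tendsto_closureForm {φ χ : ℕ → E → ℝ} (h : IsRepresentedForm μ S q A)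
    (hu : MemLp u 2 μ) (hv : MemLp v 2 μ)
    (hφ : IsApproximatingSeq μ S q φ u) (hχ : IsApproximatingSeq μ S q χ v) :
    Tendsto (fun k => q (φ k) (χ k)) atTop (𝓝 (closureForm μ S q u v)) := by
  have hd : u ∈ closureDomain μ S q ∧ v ∈ closureDomain μ S q := ⟨⟨hu, φ, hφ⟩, ⟨hv, χ, hχ⟩⟩
  have hφ' := hd.1.2.choose_spec
  have hχ' := hd.2.2.choose_spec
  rw [closureForm, dif_pos hd]
  have hlim := (h.cauchySeq hφ' hχ').tendsto_limUnder
  set φ' := hd.1.2.choose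
  set χ' := hd.2.2.choose
  obtain ⟨C, N, hC⟩ := h.exists_bound_self hφ
  obtain ⟨C', N', hC'⟩ := h.exists_bound_self hχ'
  -- q(φ, χ) = q(φ', χ') + q(φ - φ', χ') + q(φ, χ - χ'). Both differences approximate 0, so their
  -- energies vanish, and Cauchy–Schwarz removes the last two terms.
  have h1 := h.tendsto_zero_of_self (fun k => S.sub_mem (hφ.mem k) (hφ'.mem k)) hχ'.mem
    (eventually_atTop.2 ⟨N', hC'⟩) (h.tendsto_self_zero (h.isApproximatingSeq_sub hu hφ hφ'))
  have h2 := h.tendsto_zero_of_self (fun k => S.sub_mem (hχ.mem k) (hχ'.mem k)) hφ.mem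
    (eventually_atTop.2 ⟨N, hC⟩) (h.tendsto_self_zero (h.isApproximatingSeq_sub hv hχ hχ'))
  have := (hlim.add h1).add h2
  simp only [add_zero] at this
  refine this.congr fun k => ?_
  rw [h.sub_left (hφ.mem k) (hφ'.mem k) (hχ'.mem k),
    h.symm _ (S.sub_mem (hχ.mem k) (hχ'.mem k)) _ (hφ.mem k),
    h.sub_right (hφ.mem k) (hχ.mem k) (hχ'.mem k)]
  ring

lemma isApproximatingSeq_const (h : IsRepresentedForm μ S q A) (hφ : φ ∈ S) :
    IsApproximatingSeq μ S q (fun _ => φ) φ where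
  mem _ := hφ
  tendsto := by simp
  cauchy ε hε := ⟨0, fun _ _ _ _ => by
    rw [h.sub_self hφ hφ]
    linarith⟩

/-- For `φ` in the original domain, `u ↦ ℰ[u, φ]` is integration against `-A φ`. -/
lemma closureForm_eq_neg_integral (h : IsRepresentedForm μ S q A)
    (hu : u ∈ closureDomain μ S q) (hφ : φ ∈ S) :
    closureForm μ S q u φ = -∫ x, A φ x * u x ∂μ := by
  obtain ⟨hu2, χ, hχ⟩ := hu
  have h1 := h.tendsto_closureForm hu2 (h.memLp _ hφ) hχ (h.isApproximatingSeq_const hφ)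
  have h2 := h.tendsto_form_right hφ hu2 hχ
  refine tendsto_nhds_unique h1 (h2.congr fun k => ?_)
  rw [h.symm _ hφ _ (hχ.mem k)]

/-- An `L²`-limit of a sequence with bounded energy lies in the domain of the closure. -/
lemma mem_closureDomain_of_bounded {φ : ℕ → E → ℝ} {C : ℝ} (h : IsRepresentedForm μ S q A)
    (hu : MemLp u 2 μ) (hφ : ∀ k, φ k ∈ S) (hC : ∀ k, q (φ k) (φ k) ≤ C)
    (hlim : Tendsto (fun k => eLpNorm (φ k - u) 2 μ) atTop (𝓝 0)) :
    u ∈ closureDomain μ S q := by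
  -- Bounded energy alone does not make φ Cauchy, so φ is replaced by convex combinations w m of its
  -- tails that nearly minimize q over K m. The infima d m increase and are bounded by C, hence
  -- converge.
  set K : ℕ → Set (E → ℝ) := fun m => convexHull ℝ (φ '' Set.Ici m) with hK
  have hKS : ∀ m, K m ⊆ S := fun m => convexHull_min
    (by rintro _ ⟨k, -, rfl⟩; exact hφ k) S.convex
  have hanti : ∀ {m k}, m ≤ k → K k ⊆ K m := fun hmk =>
    convexHull_mono (Set.image_mono (Set.Ici_subset_Ici.2 hmk))
  have hne : ∀ m, φ m ∈ K m := fun m => subset_convexHull _ _ ⟨m, Set.mem_Ici.2 le_rfl, rfl⟩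
  set d : ℕ → ℝ := fun m => sInf ((fun v => q v v) '' K m) with hd
  have hbdd : ∀ m, BddBelow ((fun v => q v v) '' K m) := fun m =>
    ⟨0, by rintro _ ⟨v, hv, rfl⟩; exact h.nonneg _ (hKS m hv)⟩
  have hle : ∀ m, ∀ v ∈ K m, d m ≤ q v v := fun m v hv => csInf_le (hbdd m) ⟨v, hv, rfl⟩
  have hmono : Monotone d := fun m k hmk =>
    csInf_le_csInf (hbdd m) ⟨_, _, hne k, rfl⟩ (Set.image_mono (hanti hmk))
  have hconv := (tendsto_atTop_ciSup hmono
    ⟨C, by rintro _ ⟨m, rfl⟩; exact (hle m _ (hne m)).trans (hC m)⟩).cauchySeq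
  have hex : ∀ m : ℕ, ∃ v ∈ K m, q v v < d m + 1 / ((m : ℝ) + 1) := fun m => by
    obtain ⟨_, ⟨v, hv, rfl⟩, hlt⟩ := exists_lt_of_csInf_lt
      (s := (fun v => q v v) '' K m) ⟨_, _, hne m, rfl⟩
      (lt_add_of_pos_right (d m) (Nat.one_div_pos_of_nat (α := ℝ) (n := m)))
    exact ⟨v, hv, hlt⟩
  choose w hwK hw using hex
  refine ⟨hu, w, fun k => hKS _ (hwK k), ?_, fun ε hε => ?_⟩
  · rw [ENNReal.tendsto_atTop_zero] at hlim ⊢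
    intro ε hε
    obtain ⟨N, hN⟩ := hlim ε hε
    refine ⟨N, fun n hn => ?_⟩
    -- An L² ball around u is convex, so it contains the convex hull of any tail lying in it.
    have hsub : K N ⊆ {v | v ∈ S ∧ eLpNorm (v - u) 2 μ ≤ ε} := by
      refine convexHull_min ?_ ?_
      · rintro _ ⟨k, hk, rfl⟩
        exact ⟨hφ k, hN k hk⟩
      · rintro v ⟨hv, hv'⟩ v' ⟨hv1, hv1'⟩ a b ha hb hab
        refine ⟨S.add_mem (S.smul_mem _ hv) (S.smul_mem _ hv1), ?_⟩
        have e : a • v + b • v' - u = a • (v - u) + b • (v' - u) := by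
          have : u = a • u + b • u := by rw [← add_smul, hab, one_smul]
          conv_lhs => rw [this]
          simp only [smul_sub]; abel
        rw [e]
        refine (eLpNorm_add_le (((h.memLp _ hv).sub hu).const_smul a).aestronglyMeasurable
          (((h.memLp _ hv1).sub hu).const_smul b).aestronglyMeasurable (by norm_num)).trans ?_
        rw [eLpNorm_const_smul, eLpNorm_const_smul, Real.enorm_of_nonneg ha,
          Real.enorm_of_nonneg hb]
        calc _ ≤ ENNReal.ofReal a * ε + ENNReal.ofReal b * ε := by gcongr
          _ = ε := by rw [← add_mul, ← ENNReal.ofReal_add ha hb, hab]; simp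
    exact (hsub (hanti hn (hwK n))).2
  · obtain ⟨N, hN⟩ := Metric.cauchySeq_iff'.1 hconv (ε / 16) (by positivity)
    obtain ⟨M, hM⟩ := exists_nat_one_div_lt (show (0 : ℝ) < ε / 16 by positivity)
    have key : ∀ j ≥ max N M, q (w j) (w j) < d N + ε / 8 := fun j hj => by
      have h1 := hN j (le_of_max_le_left hj)
      rw [Real.dist_eq] at h1
      have h2 := (abs_lt.1 h1).2
      have h3 : 1 / ((j : ℝ) + 1) ≤ 1 / ((M : ℝ) + 1) :=
        Nat.one_div_le_one_div (le_of_max_le_right hj)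
      linarith [hw j]
    refine ⟨max N M, fun j hj k hk => ?_⟩
    have hj' := hanti (le_of_max_le_left hj) (hwK j)
    have hk' := hanti (le_of_max_le_left hk) (hwK k)
    -- The midpoint of w j and w k lies in K N, so its energy is at least d N. The parallelogram law
    -- then gives q(w j - w k) < 4 (d N + ε/8) - 4 d N = ε/2.
    have hmid := hle N _ (convex_convexHull ℝ _ hj' hk' (by norm_num : (0 : ℝ) ≤ 1 / 2)
      (by norm_num : (0 : ℝ) ≤ 1 / 2) (by norm_num))
    rw [← smul_add, h.smul_self (S.add_mem (hKS _ hj') (hKS _ hk')),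
      h.add_self (hKS _ hj') (hKS _ hk')] at hmid
    rw [h.sub_self (hKS _ hj') (hKS _ hk')]
    linarith [key j hj, key k hk]

end IsRepresentedForm

/-! ### Bounded measurable functions and their stability properties. -/

/-- Bounded measurable real functions. -/
structure IsBoundedMeasurable {X : Type*} [MeasurableSpace X] (f : X → ℝ) : Prop where
  measurable : Measurable f
  bounded : ∃ C : ℝ, 0 ≤ C ∧ ∀ x, |f x| ≤ C

namespace IsBoundedMeasurable

variable {X Z : Type*} [MeasurableSpace X] [MeasurableSpace Z] {f g : X → ℝ}

lemma integrable (hf : IsBoundedMeasurable f) (μ : Measure X) [IsFiniteMeasure μ] :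
    Integrable f μ := by
  obtain ⟨C, -, hC⟩ := hf.bounded
  exact Integrable.of_bound hf.measurable.aestronglyMeasurable C
    (Eventually.of_forall fun x => by simpa using hC x)

lemma memLp (hf : IsBoundedMeasurable f) (μ : Measure X) [IsFiniteMeasure μ] (p : ℝ≥0∞) :
    MemLp f p μ := by
  obtain ⟨C, -, hC⟩ := hf.bounded
  exact MemLp.of_bound hf.measurable.aestronglyMeasurable C
    (Eventually.of_forall fun x => by simpa using hC x)

lemma add (hf : IsBoundedMeasurable f) (hg : IsBoundedMeasurable g) :
    IsBoundedMeasurable fun x => f x + g x := by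
  obtain ⟨C, h0, hC⟩ := hf.bounded
  obtain ⟨C', h0', hC'⟩ := hg.bounded
  exact ⟨hf.measurable.add hg.measurable, C + C', by positivity,
    fun x => (abs_add_le _ _).trans (add_le_add (hC x) (hC' x))⟩

lemma sub (hf : IsBoundedMeasurable f) (hg : IsBoundedMeasurable g) :
    IsBoundedMeasurable fun x => f x - g x := by
  obtain ⟨C, h0, hC⟩ := hf.bounded
  obtain ⟨C', h0', hC'⟩ := hg.bounded
  exact ⟨hf.measurable.sub hg.measurable, C + C', by positivity,
    fun x => (abs_sub _ _).trans (add_le_add (hC x) (hC' x))⟩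

lemma mul (hf : IsBoundedMeasurable f) (hg : IsBoundedMeasurable g) :
    IsBoundedMeasurable fun x => f x * g x := by
  obtain ⟨C, h0, hC⟩ := hf.bounded
  obtain ⟨C', h0', hC'⟩ := hg.bounded
  exact ⟨hf.measurable.mul hg.measurable, C * C', by positivity,
    fun x => (abs_mul _ _).trans_le (mul_le_mul (hC x) (hC' x) (abs_nonneg _) h0)⟩

lemma const (c : ℝ) : IsBoundedMeasurable fun _ : X => c :=
  ⟨measurable_const, |c|, abs_nonneg _, fun _ => le_rfl⟩

lemma pow (hf : IsBoundedMeasurable f) (n : ℕ) : IsBoundedMeasurable fun x => f x ^ n := by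
  induction n with
  | zero => simpa using const (X := X) 1
  | succ n ih => simpa only [pow_succ] using ih.mul hf

lemma sum {ι : Type*} {s : Finset ι} {f : ι → X → ℝ} (hf : ∀ i, IsBoundedMeasurable (f i)) :
    IsBoundedMeasurable fun x => ∑ i ∈ s, f i x := by
  classical
  induction s using Finset.induction_on with
  | empty => simpa using const (X := X) 0
  | insert a s ha ih => simpa only [Finset.sum_insert ha] using (hf a).add ih

lemma comp (hf : IsBoundedMeasurable f) {T : Z → X} (hT : Measurable T) :
    IsBoundedMeasurable fun z => f (T z) := by
  obtain ⟨C, h0, hC⟩ := hf.bounded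
  exact ⟨hf.measurable.comp hT, C, h0, fun z => hC (T z)⟩

lemma continuous_comp_pi {ι : Type*} [Fintype ι] {f : ι → X → ℝ}
    (hf : ∀ i, IsBoundedMeasurable (f i)) {G : (ι → ℝ) → ℝ} (hG : Continuous G) :
    IsBoundedMeasurable fun x => G fun i => f i x := by
  choose C h0 hC using fun i => (hf i).bounded
  obtain ⟨B, hB⟩ := (isCompact_univ_pi fun i : ι =>
    isCompact_Icc (a := -C i) (b := C i)).exists_bound_of_continuousOn hG.continuousOn
  exact ⟨hG.measurable.comp (measurable_pi_lambda _ fun i => (hf i).measurable), |B|,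
    abs_nonneg _, fun x => (hB _ fun i _ => abs_le.1 (hC i x)).trans (le_abs_self B)⟩

lemma continuous_comp (hf : IsBoundedMeasurable f) {G : ℝ → ℝ} (hG : Continuous G) :
    IsBoundedMeasurable fun x => G (f x) :=
  continuous_comp_pi (ι := Unit) (f := fun _ => f) (fun _ => hf)
    (G := fun v => G (v ())) (by fun_prop)

end IsBoundedMeasurable

/-! ### Polynomial approximation in C¹ on an interval. -/

section Polynomials

open Polynomial

lemma exists_derivative_eq (P : ℝ[X]) : ∃ Q : ℝ[X], derivative Q = P := by
  induction P using Polynomial.induction_on' with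
  | add p q hp hq =>
    obtain ⟨Q, rfl⟩ := hp
    obtain ⟨Q', rfl⟩ := hq
    exact ⟨Q + Q', derivative_add⟩
  | monomial n a =>
    refine ⟨monomial (n + 1) (a / (n + 1)), ?_⟩
    rw [derivative_monomial]
    have : ((n : ℝ) + 1) ≠ 0 := by positivity
    simp [this]

lemma abs_sub_le_of_abs_deriv_le {G : ℝ → ℝ} {R L : ℝ} (hG : Differentiable ℝ G)
    (hL : ∀ x ∈ Set.Icc (-R) R, |deriv G x| ≤ L) {x y : ℝ} (hx : |x| ≤ R) (hy : |y| ≤ R) :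
    |G x - G y| ≤ L * |x - y| :=
  (convex_Icc (-R) R).norm_image_sub_le_of_norm_deriv_le (fun x _ => hG x) hL
    (abs_le.1 hy) (abs_le.1 hx)

/-- Polynomials are dense in `C¹([-R, R])`. -/
lemma exists_polynomial_near_deriv {G : ℝ → ℝ} (hG : ContDiff ℝ 1 G) {R ε : ℝ} (hR : 0 ≤ R)
    (hε : 0 < ε) :
    ∃ P : ℝ[X], (∀ x, |x| ≤ R → |P.eval x - G x| ≤ ε) ∧
      ∀ x y, |x| ≤ R → |y| ≤ R → |(P.eval x - G x) - (P.eval y - G y)| ≤ ε * |x - y| := by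
  -- The derivative is approximated within ε/(R + 1) and then integrated, with the constant chosen
  -- so that the error vanishes at 0. The values then err by at most ε R/(R + 1) on |x| ≤ R.
  obtain ⟨p, hp⟩ := exists_polynomial_near_of_continuousOn (-R) R (deriv G)
    (hG.continuous_deriv le_rfl).continuousOn (ε / (R + 1)) (by positivity)
  obtain ⟨Q, rfl⟩ := exists_derivative_eq p
  have hd : Differentiable ℝ fun x => (Q + C (G 0 - Q.eval 0)).eval x - G x :=
    (Polynomial.differentiable _).sub (hG.differentiable one_ne_zero)
  have hb : ∀ x ∈ Set.Icc (-R) R,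
      |deriv (fun x => (Q + C (G 0 - Q.eval 0)).eval x - G x) x| ≤ ε / (R + 1) := fun x hx => by
    rw [deriv_fun_sub (Polynomial.differentiableAt _)
      (hG.differentiable one_ne_zero x), Polynomial.deriv]
    simpa using (hp x hx).le
  have hle : ε / (R + 1) ≤ ε := div_le_self hε.le (by linarith)
  refine ⟨Q + C (G 0 - Q.eval 0), fun x hx => ?_, fun x y hx hy => ?_⟩
  · have := abs_sub_le_of_abs_deriv_le hd hb hx (y := 0) (by simpa using hR)
    simp only [eval_add, eval_C, add_sub_cancel, sub_self, sub_zero] at this ⊢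
    refine this.trans ?_
    calc ε / (R + 1) * |x| ≤ ε / (R + 1) * (R + 1) := by gcongr; linarith
      _ = ε := div_mul_cancel₀ _ (by positivity)
  · exact (abs_sub_le_of_abs_deriv_le hd hb hx hy).trans (by gcongr)

lemma exists_lipschitz_bound {G : ℝ → ℝ} (hG : ContDiff ℝ 1 G) (R : ℝ) :
    ∃ L, 0 ≤ L ∧ ∀ x y, |x| ≤ R → |y| ≤ R → |G x - G y| ≤ L * |x - y| := by
  obtain ⟨L, hL⟩ := isCompact_Icc.exists_bound_of_continuousOn
    (s := Set.Icc (-R) R) (hG.continuous_deriv le_rfl).continuousOn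
  refine ⟨|L|, abs_nonneg _, fun x y hx hy => ?_⟩
  exact abs_sub_le_of_abs_deriv_le (hG.differentiable one_ne_zero)
    (fun x hx => (hL x hx).trans (le_abs_self L)) hx hy

lemma eval_comp_mem {E : Type*} {S : Subalgebra ℝ (E → ℝ)} {f : E → ℝ} (hf : f ∈ S)
    (Q : ℝ[X]) : (fun x => Q.eval (f x)) ∈ S := by
  have : (fun x => Q.eval (f x)) = aeval f Q := by
    ext x
    simp [Polynomial.aeval_def, Polynomial.eval₂_eq_eval_map]
  rw [this]
  exact Algebra.adjoin_le (by simpa using hf) (Polynomial.aeval_mem_adjoin_singleton ℝ f)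

end Polynomials

lemma tendsto_eLpNorm_zero_of_le {E : Type*} [MeasurableSpace E] {μ : Measure E}
    [IsProbabilityMeasure μ] {g w : ℕ → E → ℝ} {c : ℕ → ℝ} {L : ℝ}
    (hw : ∀ k, AEStronglyMeasurable (w k) μ)
    (hc : Tendsto c atTop (𝓝 0)) (hlim : Tendsto (fun k => eLpNorm (w k) 2 μ) atTop (𝓝 0))
    (hle : ∀ k, ∀ᵐ x ∂μ, |g k x| ≤ c k + L * |w k x|) :
    Tendsto (fun k => eLpNorm (g k) 2 μ) atTop (𝓝 0) := by
  have hlim' : Tendsto (fun k => ‖c k‖ₑ + ‖L‖ₑ * eLpNorm (w k) 2 μ) atTop (𝓝 0) := by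
    have h1 : Tendsto (fun k => ‖c k‖ₑ) atTop (𝓝 0) := by
      simpa [Function.comp_def] using (continuous_enorm.tendsto (0 : ℝ)).comp hc
    have h2 := ENNReal.Tendsto.const_mul (a := ‖L‖ₑ) hlim (Or.inr enorm_ne_top)
    simpa using h1.add h2
  refine tendsto_of_tendsto_of_tendsto_of_le_of_le tendsto_const_nhds hlim'
    (fun _ => zero_le) fun k => ?_
  calc eLpNorm (g k) 2 μ ≤ eLpNorm ((fun _ => c k) + L • fun x => |w k x|) 2 μ :=
        eLpNorm_mono_ae_real (by simpa using hle k)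
    _ ≤ eLpNorm (fun _ => c k) 2 μ + eLpNorm (L • fun x => |w k x|) 2 μ :=
        eLpNorm_add_le aestronglyMeasurable_const ((hw k).norm.const_smul L) (by norm_num)
    _ = ‖c k‖ₑ + ‖L‖ₑ * eLpNorm (w k) 2 μ := by
        rw [eLpNorm_const_smul, eLpNorm_const _ (by norm_num) (IsProbabilityMeasure.ne_zero μ)]
        simp only [measure_univ, ENNReal.one_rpow, mul_one]
        congr 2
        exact eLpNorm_norm (w k)

/-! ### The limit form on the algebra, its closure and its square field. -/

/-- The form `(α_n / 2) E[(φ(Y_n) - φ(Y)) (χ(Y_n) - χ(Y))]`. -/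
def approxForm {Ω E : Type*} [MeasurableSpace Ω] (P : Measure Ω) (Y : Ω → E) (Yn : ℕ → Ω → E)
    (α : ℕ → ℝ) (n : ℕ) (φ χ : E → ℝ) : ℝ :=
  α n / 2 * ∫ s, (φ (Yn n s) - φ (Y s)) * (χ (Yn n s) - χ (Y s)) ∂P

/-- `S` is an algebra of bounded measurable functions on which the approximate forms converge,
with limit represented by `A`. -/
structure IsLimitAlgebra {Ω E : Type*} [MeasurableSpace Ω] [MeasurableSpace E] (P : Measure Ω)
    (Y : Ω → E) (Yn : ℕ → Ω → E) (α : ℕ → ℝ) (S : Subalgebra ℝ (E → ℝ))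
    (A : (E → ℝ) → E → ℝ) : Prop where
  measurable_left : Measurable Y
  measurable_right : ∀ n, Measurable (Yn n)
  pos : ∀ n, 0 < α n
  bounded : ∀ φ ∈ S, IsBoundedMeasurable φ
  memLp_gen : ∀ φ ∈ S, MemLp (A φ) 2 (P.map Y)
  tendsto : ∀ φ ∈ S, ∀ χ ∈ S, Tendsto (fun n => approxForm P Y Yn α n φ χ) atTop
    (𝓝 (-∫ x, A φ x * χ x ∂(P.map Y)))

namespace IsLimitAlgebra

variable {Ω E : Type*} [MeasurableSpace Ω] [MeasurableSpace E] {P : Measure Ω}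
  [IsProbabilityMeasure P] {Y : Ω → E} {Yn : ℕ → Ω → E} {α : ℕ → ℝ} {S : Subalgebra ℝ (E → ℝ)}
  {A : (E → ℝ) → E → ℝ} {φ χ ψ f g h u : E → ℝ}

lemma isProbabilityMeasure_map (H : IsLimitAlgebra P Y Yn α S A) :
    IsProbabilityMeasure (P.map Y) :=
  Measure.isProbabilityMeasure_map H.measurable_left.aemeasurable

lemma increment (H : IsLimitAlgebra P Y Yn α S A) (hφ : IsBoundedMeasurable φ) (n : ℕ) :
    IsBoundedMeasurable fun s => φ (Yn n s) - φ (Y s) :=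
  (hφ.comp (H.measurable_right n)).sub (hφ.comp H.measurable_left)

lemma mul_integral_mono (H : IsLimitAlgebra P Y Yn α S A) (n : ℕ) {V W : Ω → ℝ}
    (hV : IsBoundedMeasurable V) (hW : IsBoundedMeasurable W) (hle : ∀ s, V s ≤ W s) :
    α n * ∫ s, V s ∂P ≤ α n * ∫ s, W s ∂P :=
  mul_le_mul_of_nonneg_left (integral_mono (hV.integrable P) (hW.integrable P) hle) (H.pos n).le

lemma tendsto_preLimitForm (H : IsLimitAlgebra P Y Yn α S A) (hφ : φ ∈ S) (hχ : χ ∈ S) :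
    Tendsto (fun n => approxForm P Y Yn α n φ χ) atTop (𝓝 (preLimitForm P Y Yn α φ χ)) :=
  tendsto_nhds_limUnder ⟨_, H.tendsto φ hφ χ hχ⟩

lemma approxForm_comm (n : ℕ) (φ χ : E → ℝ) :
    approxForm P Y Yn α n φ χ = approxForm P Y Yn α n χ φ := by
  simp only [approxForm, mul_comm]

lemma approxForm_self_nonneg (H : IsLimitAlgebra P Y Yn α S A) (n : ℕ) (φ : E → ℝ) :
    0 ≤ approxForm P Y Yn α n φ φ :=
  mul_nonneg (div_nonneg (H.pos n).le zero_le_two) (integral_nonneg fun _ => mul_self_nonneg _)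

/-- Pointwise bounds on increments pass to the approximate forms and to their limit. This takes the
place of an abstract contraction property in the energy estimates. -/
lemma approxForm_self_le (H : IsLimitAlgebra P Y Yn α S A) (hφ : IsBoundedMeasurable φ)
    (hχ : IsBoundedMeasurable χ) (hψ : IsBoundedMeasurable ψ) {a b : ℝ}
    (hle : ∀ x y, (φ x - φ y) ^ 2 ≤ a * (χ x - χ y) ^ 2 + b * (ψ x - ψ y) ^ 2) (n : ℕ) :
    approxForm P Y Yn α n φ φ ≤
      a * approxForm P Y Yn α n χ χ + b * approxForm P Y Yn α n ψ ψ := by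
  have h1 := (H.increment hφ n).mul (H.increment hφ n)
  have h2 := (H.increment hχ n).mul (H.increment hχ n)
  have h3 := (H.increment hψ n).mul (H.increment hψ n)
  have key := H.mul_integral_mono n h1
    (((IsBoundedMeasurable.const a).mul h2).add ((IsBoundedMeasurable.const b).mul h3))
    fun s => by simpa only [sq] using hle (Yn n s) (Y s)
  rw [integral_add (((IsBoundedMeasurable.const a).mul h2).integrable P)
    (((IsBoundedMeasurable.const b).mul h3).integrable P), integral_const_mul,
    integral_const_mul] at key
  simp only [approxForm]
  linarith

lemma abs_approxForm_sub_le (H : IsLimitAlgebra P Y Yn α S A) {φ' χ' : E → ℝ}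
    (hφ : IsBoundedMeasurable φ) (hχ : IsBoundedMeasurable χ) (hφ' : IsBoundedMeasurable φ')
    (hχ' : IsBoundedMeasurable χ') (hψ : IsBoundedMeasurable ψ) {c : ℝ}
    (hle : ∀ x y, |(φ x - φ y) * (χ x - χ y) - (φ' x - φ' y) * (χ' x - χ' y)| ≤
      c * (ψ x - ψ y) ^ 2) (n : ℕ) :
    |approxForm P Y Yn α n φ χ - approxForm P Y Yn α n φ' χ'| ≤
      c * approxForm P Y Yn α n ψ ψ := by
  have h1 := (H.increment hφ n).mul (H.increment hχ n)
  have h2 := (H.increment hφ' n).mul (H.increment hχ' n)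
  have h3 := (IsBoundedMeasurable.const c).mul ((H.increment hψ n).mul (H.increment hψ n))
  have key := norm_integral_le_of_norm_le (h3.integrable P)
    (f := fun s => (φ (Yn n s) - φ (Y s)) * (χ (Yn n s) - χ (Y s)) -
      (φ' (Yn n s) - φ' (Y s)) * (χ' (Yn n s) - χ' (Y s)))
    (Eventually.of_forall fun s => by
      simpa only [sq, Real.norm_eq_abs] using hle (Yn n s) (Y s))
  rw [integral_sub (h1.integrable P) (h2.integrable P), integral_const_mul,
    Real.norm_eq_abs] at key
  have hp : 0 < α n / 2 := half_pos (H.pos n)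
  simp only [approxForm]
  rw [← mul_sub, abs_mul, abs_of_pos hp, mul_left_comm]
  exact mul_le_mul_of_nonneg_left key hp.le

lemma preLimitForm_self_le (H : IsLimitAlgebra P Y Yn α S A) (hφ : φ ∈ S)
    (hχ : χ ∈ S) (hψ : ψ ∈ S) {a b : ℝ}
    (hle : ∀ x y, (φ x - φ y) ^ 2 ≤ a * (χ x - χ y) ^ 2 + b * (ψ x - ψ y) ^ 2) :
    preLimitForm P Y Yn α φ φ ≤
      a * preLimitForm P Y Yn α χ χ + b * preLimitForm P Y Yn α ψ ψ :=
  le_of_tendsto_of_tendsto' (H.tendsto_preLimitForm hφ hφ)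
    (((H.tendsto_preLimitForm hχ hχ).const_mul a).add
      ((H.tendsto_preLimitForm hψ hψ).const_mul b))
    (H.approxForm_self_le (H.bounded _ hφ) (H.bounded _ hχ) (H.bounded _ hψ) hle)

lemma preLimitForm_self_le_of_abs_le (H : IsLimitAlgebra P Y Yn α S A) (hφ : φ ∈ S)
    (hχ : χ ∈ S) {L : ℝ} (hle : ∀ x y, |φ x - φ y| ≤ L * |χ x - χ y|) :
    preLimitForm P Y Yn α φ φ ≤ L ^ 2 * preLimitForm P Y Yn α χ χ := by
  have := H.preLimitForm_self_le hφ hχ hχ (a := L ^ 2) (b := 0) fun x y => by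
    have := pow_le_pow_left₀ (abs_nonneg _) (hle x y) 2
    rw [mul_pow, sq_abs, sq_abs] at this
    linarith
  linarith

lemma isRepresentedForm (H : IsLimitAlgebra P Y Yn α S A) :
    IsRepresentedForm (P.map Y) (Subalgebra.toSubmodule S) (preLimitForm P Y Yn α) A where
  memLp φ hφ := by
    have := H.isProbabilityMeasure_map
    exact (H.bounded φ hφ).memLp _ _
  memLp_gen φ hφ := H.memLp_gen φ hφ
  eq_neg_integral φ hφ χ hχ := (H.tendsto φ hφ χ hχ).limUnder_eq
  symm φ hφ χ hχ := tendsto_nhds_unique (H.tendsto_preLimitForm hφ hχ)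
    ((H.tendsto_preLimitForm hχ hφ).congr fun n => approxForm_comm n χ φ)
  nonneg φ hφ := ge_of_tendsto' (H.tendsto_preLimitForm hφ hφ)
    fun n => H.approxForm_self_nonneg n φ

/-- Polynomials that approximate `G` in `C¹` on the range of `f ∈ S` give an approximating
sequence of `G ∘ f`. -/
lemma isApproximatingSeq_eval (H : IsLimitAlgebra P Y Yn α S A) (hf : f ∈ S) {R : ℝ}
    (hR : ∀ x, |f x| ≤ R) {G : ℝ → ℝ} {Q : ℕ → Polynomial ℝ}
    (hQ : ∀ k x, |x| ≤ R → |(Q k).eval x - G x| ≤ 1 / ((k : ℝ) + 1))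
    (hQ' : ∀ k x y, |x| ≤ R → |y| ≤ R →
      |((Q k).eval x - G x) - ((Q k).eval y - G y)| ≤ 1 / ((k : ℝ) + 1) * |x - y|) :
    IsApproximatingSeq (P.map Y) S (preLimitForm P Y Yn α)
      (fun k x => (Q k).eval (f x)) (G ∘ f) where
  mem k := eval_comp_mem hf _
  tendsto := by
    have := H.isProbabilityMeasure_map
    exact tendsto_eLpNorm_zero_of_le (w := fun _ => 0) (L := 0)
      (fun _ => aestronglyMeasurable_zero) tendsto_one_div_add_atTop_nhds_zero_nat (by simp)
      fun k => Eventually.of_forall fun x => by simpa using hQ k _ (hR x)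
  cauchy ε hε := by
    have hq0 := H.isRepresentedForm.nonneg f hf
    set q0 := preLimitForm P Y Yn α f f
    -- For j, k ≥ N the increments of Q_j(f) - Q_k(f) are at most 2/(N + 1) times those of f.
    have hlim : Tendsto (fun N : ℕ => (2 * (1 / ((N : ℝ) + 1))) ^ 2 * q0) atTop (𝓝 0) := by
      have := ((tendsto_one_div_add_atTop_nhds_zero_nat (𝕜 := ℝ)).const_mul 2).pow 2
      simpa using this.mul_const q0
    obtain ⟨N, hN⟩ := (hlim.eventually (gt_mem_nhds hε)).exists
    refine ⟨N, fun j hj k hk => lt_of_le_of_lt ?_ hN⟩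
    refine H.preLimitForm_self_le_of_abs_le
      (S.sub_mem (eval_comp_mem hf _) (eval_comp_mem hf _)) hf fun x y => ?_
    have h1 := hQ' j _ _ (hR x) (hR y)
    have h2 := hQ' k _ _ (hR x) (hR y)
    have hj' : 1 / ((j : ℝ) + 1) * |f x - f y| ≤ 1 / ((N : ℝ) + 1) * |f x - f y| :=
      mul_le_mul_of_nonneg_right (Nat.one_div_le_one_div hj) (abs_nonneg _)
    have hk' : 1 / ((k : ℝ) + 1) * |f x - f y| ≤ 1 / ((N : ℝ) + 1) * |f x - f y| :=
      mul_le_mul_of_nonneg_right (Nat.one_div_le_one_div hk) (abs_nonneg _)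
    simp only [Pi.sub_apply]
    calc _ = |(((Q j).eval (f x) - G (f x)) - ((Q j).eval (f y) - G (f y))) -
          (((Q k).eval (f x) - G (f x)) - ((Q k).eval (f y) - G (f y)))| := by ring_nf
      _ ≤ _ := abs_sub _ _
      _ ≤ _ := by linarith

lemma exists_approxForm_bound (H : IsLimitAlgebra P Y Yn α S A) (hf : f ∈ S) :
    ∃ C, 0 < C ∧ ∀ n, approxForm P Y Yn α n f f ≤ C := by
  obtain ⟨C, hC⟩ := (H.tendsto_preLimitForm hf hf).bddAbove_range
  exact ⟨max C 1, by positivity, fun n => (hC ⟨n, rfl⟩).trans (le_max_left _ _)⟩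

/-- The approximate forms converge to the closed form on `C¹` functions of `f ∈ S`. -/
lemma tendsto_approxForm_comp (H : IsLimitAlgebra P Y Yn α S A) (hf : f ∈ S) {G K : ℝ → ℝ}
    (hG : ContDiff ℝ 1 G) (hK : ContDiff ℝ 1 K) :
    Tendsto (fun n => approxForm P Y Yn α n (G ∘ f) (K ∘ f)) atTop
      (𝓝 (closureForm (P.map Y) S (preLimitForm P Y Yn α) (G ∘ f) (K ∘ f))) := by
  have := H.isProbabilityMeasure_map
  have hfb := H.bounded f hf
  obtain ⟨R, hR0, hR⟩ := hfb.bounded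
  obtain ⟨C, hC0, hC⟩ := H.exists_approxForm_bound hf
  choose Q hQ hQ' using fun k : ℕ =>
    exists_polynomial_near_deriv hG hR0 (Nat.one_div_pos_of_nat (α := ℝ) (n := k))
  choose T hT hT' using fun k : ℕ =>
    exists_polynomial_near_deriv hK hR0 (Nat.one_div_pos_of_nat (α := ℝ) (n := k))
  obtain ⟨L, hL0, hL⟩ := exists_lipschitz_bound hG R
  obtain ⟨M, hM0, hM⟩ := exists_lipschitz_bound hK R
  have hGf : IsBoundedMeasurable (G ∘ f) := hfb.continuous_comp hG.continuous
  have hKf : IsBoundedMeasurable (K ∘ f) := hfb.continuous_comp hK.continuous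
  have hlim := H.isRepresentedForm.tendsto_closureForm (hGf.memLp _ 2) (hKf.memLp _ 2)
    (H.isApproximatingSeq_eval hf hR hQ hQ') (H.isApproximatingSeq_eval hf hR hT hT')
  change Tendsto _ _ (𝓝 (closureForm (P.map Y) S (preLimitForm P Y Yn α) (G ∘ f) (K ∘ f)))
    at hlim
  set c := closureForm (P.map Y) S (preLimitForm P Y Yn α) (G ∘ f) (K ∘ f)
  -- G ∘ f and K ∘ f need not lie in the algebra. The error of their polynomial replacement is
  -- uniform in n, which allows the limits in n and k to be exchanged. With d = |f x - f y|, the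
  -- three summands of the constant bound |a t| by L δ d², |r b| by M δ d² and |r t| by δ d².
  have hest : ∀ k n, |approxForm P Y Yn α n (G ∘ f) (K ∘ f) -
      approxForm P Y Yn α n (fun x => (Q k).eval (f x)) (fun x => (T k).eval (f x))| ≤
      1 / ((k : ℝ) + 1) * ((L + M + 1) * C) := fun k n => by
    have hδ : 0 < 1 / ((k : ℝ) + 1) := Nat.one_div_pos_of_nat
    have hδ1 : 1 / ((k : ℝ) + 1) ≤ 1 := by
      simpa using Nat.one_div_le_one_div (α := ℝ) (Nat.zero_le k)
    have key := H.abs_approxForm_sub_le hGf hKf (H.bounded _ (eval_comp_mem hf (Q k)))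
      (H.bounded _ (eval_comp_mem hf (T k))) hfb (c := 1 / ((k : ℝ) + 1) * (L + M + 1))
      (fun x y => by
        have h1 := hQ' k _ _ (hR x) (hR y)
        have h2 := hT' k _ _ (hR x) (hR y)
        have h3 := hL _ _ (hR x) (hR y)
        have h4 := hM _ _ (hR x) (hR y)
        set δ := 1 / ((k : ℝ) + 1)
        set a := G (f x) - G (f y)
        set b := K (f x) - K (f y)
        set r := (Q k).eval (f x) - G (f x) - ((Q k).eval (f y) - G (f y))
        set t := (T k).eval (f x) - K (f x) - ((T k).eval (f y) - K (f y))
        set d := |f x - f y|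
        have hd : 0 ≤ d := abs_nonneg _
        have e1 : (Q k).eval (f x) - (Q k).eval (f y) = a + r := by simp only [a, r]; ring
        have e2 : (T k).eval (f x) - (T k).eval (f y) = b + t := by simp only [b, t]; ring
        have e3 : (f x - f y) ^ 2 = d ^ 2 := (sq_abs _).symm
        rw [e1, e2, e3]
        change |a * b - _| ≤ _
        calc |a * b - (a + r) * (b + t)| = |a * t + r * b + r * t| := by
              rw [← abs_neg]; ring_nf
          _ ≤ |a| * |t| + |r| * |b| + |r| * |t| := by
              refine (abs_add_three _ _ _).trans ?_
              simp only [abs_mul, le_refl]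
          _ ≤ (L * d) * (δ * d) + (δ * d) * (M * d) + (δ * d) * (1 * d) := by
              have h5 : δ * d ≤ 1 * d := mul_le_mul_of_nonneg_right hδ1 hd
              gcongr
              exact h2.trans h5
          _ = δ * (L + M + 1) * d ^ 2 := by ring) n
    refine key.trans ?_
    rw [mul_assoc]
    gcongr
    exact hC n
  have hsmall : Tendsto (fun k : ℕ => 1 / ((k : ℝ) + 1) * ((L + M + 1) * C)) atTop (𝓝 0) := by
    simpa using (tendsto_one_div_add_atTop_nhds_zero_nat (𝕜 := ℝ)).mul_const ((L + M + 1) * C)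
  rw [Metric.tendsto_atTop]
  intro ε hε
  obtain ⟨k, hk1, hk2⟩ := ((hsmall.eventually (gt_mem_nhds (show 0 < ε / 3 by positivity))).and
    (hlim.eventually (Metric.ball_mem_nhds c (show 0 < ε / 3 by positivity)))).exists
  obtain ⟨N, hN⟩ := Metric.tendsto_atTop.1
    (H.tendsto_preLimitForm (eval_comp_mem hf (Q k)) (eval_comp_mem hf (T k)))
    (ε / 3) (by positivity)
  refine ⟨N, fun n hn => ?_⟩
  have h1 := hest k n
  rw [← Real.dist_eq] at h1
  have h2 := hN n hn
  have h3 := dist_triangle4 (approxForm P Y Yn α n (G ∘ f) (K ∘ f))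
    (approxForm P Y Yn α n (fun x => (Q k).eval (f x)) (fun x => (T k).eval (f x)))
    (preLimitForm P Y Yn α (fun x => (Q k).eval (f x)) (fun x => (T k).eval (f x))) c
  linarith

lemma mem_closureDomain (H : IsLimitAlgebra P Y Yn α S A) (hf : f ∈ S) :
    f ∈ closureDomain (P.map Y) S (preLimitForm P Y Yn α) :=
  ⟨H.isRepresentedForm.memLp f hf, _, H.isRepresentedForm.isApproximatingSeq_const hf⟩

/-- The bounded functions in the domain of the closed form are stable under multiplication by
members of the algebra. -/
lemma mul_mem_closureDomain (H : IsLimitAlgebra P Y Yn α S A) (hf : f ∈ S)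
    (hh : h ∈ closureDomain (P.map Y) S (preLimitForm P Y Yn α)) (hh' : MemLp h ∞ (P.map Y)) :
    f * h ∈ closureDomain (P.map Y) S (preLimitForm P Y Yn α) := by
  have := H.isProbabilityMeasure_map
  have HR := H.isRepresentedForm
  obtain ⟨hh2, φ, hφ⟩ := hh
  have hM : ∀ᵐ x ∂(P.map Y), |h x| ≤ (eLpNormEssSup h (P.map Y)).toReal := by
    filter_upwards [ae_le_eLpNormEssSup (f := h) (μ := P.map Y)] with x hx
    have := ENNReal.toReal_mono (by simpa using hh'.2.ne) hx
    rwa [toReal_enorm] at this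
  set M := (eLpNormEssSup h (P.map Y)).toReal
  have hM0 : 0 ≤ M := ENNReal.toReal_nonneg
  obtain ⟨C, hC0, hC⟩ := (H.bounded f hf).bounded
  -- T is a smooth bounded truncation equal to the identity on [-M, M]. Thus T ∘ h = h almost
  -- everywhere, while T ∘ φ_k is bounded uniformly in k.
  let b : ContDiffBump (0 : ℝ) := ⟨M + 1, M + 2, by linarith, by linarith⟩
  set T : ℝ → ℝ := fun x => x * b x with hTdef
  have hT : ContDiff ℝ 1 T := contDiff_id.mul b.contDiff
  have hTc : HasCompactSupport T := b.hasCompactSupport.mul_left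
  have hTM : ∀ x, |x| ≤ M → T x = x := fun x hx => by
    rw [hTdef]
    simp only
    rw [b.one_of_mem_closedBall (by
      rw [mem_closedBall_zero_iff]
      exact hx.trans (by simp [b])), mul_one]
  obtain ⟨B, hB⟩ := hTc.exists_bound_of_continuous hT.continuous
  obtain ⟨L, hL⟩ := hTc.deriv.exists_bound_of_continuous (hT.continuous_deriv le_rfl)
  have hB0 : 0 ≤ B := (norm_nonneg _).trans (hB 0)
  have hL0 : 0 ≤ L := (norm_nonneg _).trans (hL 0)
  have hTL : ∀ x y, |T x - T y| ≤ L * |x - y| := fun x y =>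
    abs_sub_le_of_abs_deriv_le (hT.differentiable one_ne_zero) (fun z _ => hL z)
      (le_max_left |x| |y|) (le_max_right |x| |y|)
  choose R hR0 hR using fun k => (H.bounded _ (hφ.mem k)).bounded
  -- T ∘ φ_k may leave the algebra, so T is replaced by a polynomial close to it in C¹ on the range
  -- of φ_k.
  choose Q hQ hQ' using fun k : ℕ =>
    exists_polynomial_near_deriv hT (hR0 k) (Nat.one_div_pos_of_nat (α := ℝ) (n := k))
  have hδ1 : ∀ k : ℕ, 1 / ((k : ℝ) + 1) ≤ 1 := fun k => by
    simpa using Nat.one_div_le_one_div (α := ℝ) (Nat.zero_le k)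
  set ψ : ℕ → E → ℝ := fun k x => (Q k).eval (φ k x) with hψ
  have hψS : ∀ k, ψ k ∈ S := fun k => eval_comp_mem (hφ.mem k) _
  have hψB : ∀ k x, |ψ k x| ≤ B + 1 := fun k x => by
    have h1 := (hQ k _ (hR k x)).trans (hδ1 k)
    have h2 := hB (φ k x)
    rw [Real.norm_eq_abs] at h2
    calc |ψ k x| = |(ψ k x - T (φ k x)) + T (φ k x)| := by ring_nf
      _ ≤ _ := abs_add_le _ _
      _ ≤ B + 1 := by linarith
  have hψL : ∀ k x y, |ψ k x - ψ k y| ≤ (L + 1) * |φ k x - φ k y| := fun k x y => by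
    have h1 := (hQ' k _ _ (hR k x) (hR k y)).trans
      (mul_le_mul_of_nonneg_right (hδ1 k) (abs_nonneg _))
    have h2 := hTL (φ k x) (φ k y)
    calc |ψ k x - ψ k y| = |((ψ k x - T (φ k x)) - (ψ k y - T (φ k y))) +
          (T (φ k x) - T (φ k y))| := by ring_nf
      _ ≤ _ := abs_add_le _ _
      _ ≤ _ := by linarith
  have hfh : MemLp (f * h) 2 (P.map Y) := hh2.mul ((H.bounded f hf).memLp _ ∞)
  obtain ⟨K, N, hK⟩ := HR.exists_bound_self hφ
  -- The shift by N is needed because the energies of φ_k are only bounded from N on. The energy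
  -- bound comes from writing the increment of fψ as f(x) (ψ(x) - ψ(y)) + ψ(y) (f(x) - f(y)) and
  -- from (a + b)² ≤ 2a² + 2b².
  refine HR.mem_closureDomain_of_bounded (φ := fun k => f * ψ (k + N))
    (C := 2 * C ^ 2 * ((L + 1) ^ 2 * K) + 2 * (B + 1) ^ 2 * preLimitForm P Y Yn α f f) hfh
    (fun k => S.mul_mem hf (hψS _)) (fun k => ?_) ?_
  · have h1 := H.preLimitForm_self_le (S.mul_mem hf (hψS (k + N))) (hψS (k + N)) hf
      (a := 2 * C ^ 2) (b := 2 * (B + 1) ^ 2) fun x y => by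
        have e1 : (f x * (ψ (k + N) x - ψ (k + N) y)) ^ 2 ≤
            C ^ 2 * (ψ (k + N) x - ψ (k + N) y) ^ 2 := by
          rw [mul_pow]
          exact mul_le_mul_of_nonneg_right (sq_le_sq' (abs_le.1 (hC x)).1 (abs_le.1 (hC x)).2)
            (sq_nonneg _)
        have e2 : (ψ (k + N) y * (f x - f y)) ^ 2 ≤ (B + 1) ^ 2 * (f x - f y) ^ 2 := by
          rw [mul_pow]
          exact mul_le_mul_of_nonneg_right (sq_le_sq' (abs_le.1 (hψB _ y)).1
            (abs_le.1 (hψB _ y)).2) (sq_nonneg _)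
        have e3 := add_sq_le (a := f x * (ψ (k + N) x - ψ (k + N) y))
          (b := ψ (k + N) y * (f x - f y))
        simp only [Pi.mul_apply]
        calc _ = (f x * (ψ (k + N) x - ψ (k + N) y) + ψ (k + N) y * (f x - f y)) ^ 2 := by ring
          _ ≤ _ := e3
          _ ≤ _ := by linarith
    have h2 := H.preLimitForm_self_le_of_abs_le (hψS (k + N)) (hφ.mem (k + N)) (hψL (k + N))
    refine h1.trans (add_le_add_left (mul_le_mul_of_nonneg_left (h2.trans ?_) (by positivity)) _)
    exact mul_le_mul_of_nonneg_left (hK _ (Nat.le_add_left _ _)) (by positivity)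
  · suffices hs : Tendsto (fun k => eLpNorm (f * ψ k - f * h) 2 (P.map Y)) atTop (𝓝 0) from
      hs.comp (tendsto_add_atTop_nat N)
    refine tendsto_eLpNorm_zero_of_le (c := fun k : ℕ => C * (1 / ((k : ℝ) + 1))) (L := C * L)
      (w := fun k => φ k - h)
      (fun k => ((HR.memLp _ (hφ.mem k)).sub hh2).aestronglyMeasurable)
      (by simpa using (tendsto_one_div_add_atTop_nhds_zero_nat (𝕜 := ℝ)).const_mul C)
      hφ.tendsto fun k => ?_
    filter_upwards [hM] with x hx
    have h1 := hQ k _ (hR k x)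
    have h2 := hTL (φ k x) (h x)
    rw [hTM _ hx] at h2
    simp only [Pi.sub_apply, Pi.mul_apply]
    rw [← mul_sub, abs_mul, mul_assoc, ← mul_add]
    refine mul_le_mul (hC x) ?_ (abs_nonneg _) hC0
    calc |ψ k x - h x| = |(ψ k x - T (φ k x)) + (T (φ k x) - h x)| := by ring_nf
      _ ≤ _ := abs_add_le _ _
      _ ≤ _ := add_le_add h1 h2

/-- The square field of the closed form at `f, g ∈ S`. -/
def squareField (A : (E → ℝ) → E → ℝ) (f g : E → ℝ) : E → ℝ :=
  fun x => A (f * g) x - f x * A g x - g x * A f x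

lemma memLp_mul_gen (H : IsLimitAlgebra P Y Yn α S A) (hf : IsBoundedMeasurable f)
    (hg : g ∈ S) : MemLp (fun x => f x * A g x) 2 (P.map Y) := by
  have := H.isProbabilityMeasure_map
  exact (H.memLp_gen g hg).mul (hf.memLp _ ∞)

lemma memLp_squareField (H : IsLimitAlgebra P Y Yn α S A) (hf : f ∈ S) (hg : g ∈ S) :
    MemLp (squareField A f g) 2 (P.map Y) :=
  ((H.memLp_gen _ (S.mul_mem hf hg)).sub (H.memLp_mul_gen (H.bounded f hf) hg)).sub
    (H.memLp_mul_gen (H.bounded g hg) hf)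

lemma integral_mul_squareField (H : IsLimitAlgebra P Y Yn α S A) (hf : f ∈ S) (hg : g ∈ S)
    (hh : MemLp h 2 (P.map Y)) :
    ∫ x, h x * squareField A f g x ∂(P.map Y) =
      -(∫ x, A g x * (f x * h x) ∂(P.map Y)) + -(∫ x, A f x * (g x * h x) ∂(P.map Y)) -
        -∫ x, A (f * g) x * h x ∂(P.map Y) := by
  have h1 := (H.memLp_gen _ (S.mul_mem hf hg)).integrable_mul hh
  have h2 := (H.memLp_mul_gen (H.bounded f hf) hg).integrable_mul hh
  have h3 := (H.memLp_mul_gen (H.bounded g hg) hf).integrable_mul hh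
  have e := integral_sub (h1.sub h2) h3
  have e' := integral_sub h1 h2
  simp only [Pi.mul_apply, Pi.sub_apply] at e e'
  rw [e'] at e
  calc ∫ x, h x * squareField A f g x ∂(P.map Y)
      = ∫ x, A (f * g) x * h x - f x * A g x * h x - g x * A f x * h x ∂(P.map Y) := by
        congr 1; ext x; simp only [squareField]; ring
    _ = _ := by
        rw [e]
        simp only [← mul_assoc, mul_comm (A g _) (f _), mul_comm (A f _) (g _)]
        ring

/-- In each of the three terms one argument (g, f or fg) lies in the algebra, so the closed form is
an integral against A of that argument. -/
lemma isSquareField (H : IsLimitAlgebra P Y Yn α S A) (hf : f ∈ S) (hg : g ∈ S) :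
    IsSquareField (P.map Y) (closureDomain (P.map Y) S (preLimitForm P Y Yn α))
      (closureForm (P.map Y) S (preLimitForm P Y Yn α)) f g (squareField A f g) := by
  have := H.isProbabilityMeasure_map
  refine ⟨(H.memLp_squareField hf hg).integrable (by norm_num), fun w hw hw' => ?_⟩
  rw [H.integral_mul_squareField hf hg hw.1]
  have HR := H.isRepresentedForm
  have e1 := HR.closureForm_eq_neg_integral (H.mul_mem_closureDomain hf hw hw') hg
  have e2 := HR.closureForm_eq_neg_integral (H.mul_mem_closureDomain hg hw hw') hf
  have e3 := HR.closureForm_eq_neg_integral hw (S.mul_mem hf hg)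
  simp only [Pi.mul_apply, Subalgebra.coe_toSubmodule] at e1 e2 e3
  rw [e1, e2, e3]

end IsLimitAlgebra

/-! ### Auxiliary estimates: Taylor remainder, norms on a finite product, Stone–Weierstrass. -/

lemma tendsto_zero_of_forall_abs_le {a : ℕ → ℝ} (h : ∀ η : ℝ, 0 < η →
    ∃ b : ℕ → ℝ, Tendsto b atTop (𝓝 0) ∧ ∀ n, |a n| ≤ η + b n) : Tendsto a atTop (𝓝 0) := by
  rw [Metric.tendsto_atTop]
  intro ε hε
  obtain ⟨b, hb, hab⟩ := h (ε / 2) (by positivity)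
  obtain ⟨N, hN⟩ := eventually_atTop.1 (hb.eventually (gt_mem_nhds (half_pos hε)))
  refine ⟨N, fun n hn => ?_⟩
  rw [Real.dist_eq, sub_zero]
  linarith [hab n, hN n hn]

/-- Uniform first order Taylor expansion of a `C¹` function on a ball, with a remainder that is
small near the diagonal. -/
lemma exists_sq_remainder_le {V : Type*} [NormedAddCommGroup V] [NormedSpace ℝ V]
    [ProperSpace V] {F : V → ℝ} (hF : ContDiff ℝ 1 F) (R : ℝ) {ε : ℝ} (hε : 0 < ε) :
    ∃ C, 0 ≤ C ∧ ∀ x y, ‖x‖ ≤ R → ‖y‖ ≤ R →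
      (F y - F x - fderiv ℝ F x (y - x)) ^ 2 ≤ ε ^ 2 * ‖y - x‖ ^ 2 + C * ‖y - x‖ ^ 4 := by
  have hcont : Continuous (fderiv ℝ F) := hF.continuous_fderiv one_ne_zero
  have hK := isCompact_closedBall (0 : V) R
  obtain ⟨M, hM⟩ := hK.exists_bound_of_continuousOn hcont.continuousOn
  obtain ⟨δ, hδ, hunif⟩ := Metric.uniformContinuousOn_iff.1
    (hK.uniformContinuousOn_of_continuous hcont.continuousOn) ε hε
  -- If ‖y - x‖ < δ, uniform continuity of the derivative bounds the remainder by ε ‖y - x‖.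
  -- Otherwise it is at most 2M ‖y - x‖ ≤ (2M/δ) ‖y - x‖², whose square gives the quartic term.
  refine ⟨(2 * M / δ) ^ 2, sq_nonneg _, fun x y hx hy => ?_⟩
  have hx' : x ∈ Metric.closedBall (0 : V) R := by simpa using hx
  have hy' : y ∈ Metric.closedBall (0 : V) R := by simpa using hy
  have hM0 : 0 ≤ M := (norm_nonneg _).trans (hM x hx')
  rcases lt_or_ge ‖y - x‖ δ with h | h
  · have key := (convex_segment x y).norm_image_sub_le_of_norm_fderiv_le' (𝕜 := ℝ) (f := F)
      (φ := fderiv ℝ F x) (C := ε) (fun z _ => hF.differentiable one_ne_zero z)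
      (fun z hz => by
        have hz' := (convex_closedBall (0 : V) R).segment_subset hx' hy' hz
        have := hunif z hz' x hx' (by
          rw [dist_eq_norm]
          exact (norm_sub_le_of_mem_segment hz).trans_lt h)
        rw [dist_eq_norm] at this
        exact this.le) (left_mem_segment ℝ x y) (right_mem_segment ℝ x y)
    have := pow_le_pow_left₀ (norm_nonneg _) key 2
    rw [mul_pow, Real.norm_eq_abs, sq_abs] at this
    have : 0 ≤ (2 * M / δ) ^ 2 * ‖y - x‖ ^ 4 := by positivity
    linarith
  · have key := (convex_closedBall (0 : V) R).norm_image_sub_le_of_norm_fderiv_le' (𝕜 := ℝ)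
      (f := F) (φ := fderiv ℝ F x) (C := 2 * M) (fun z _ => hF.differentiable one_ne_zero z)
      (fun z hz => (norm_sub_le _ _).trans (by linarith [hM z hz, hM x hx'])) hx' hy'
    have h1 : 2 * M * ‖y - x‖ ≤ 2 * M / δ * ‖y - x‖ ^ 2 := by
      rw [div_mul_eq_mul_div, le_div_iff₀ hδ, sq, ← mul_assoc]
      gcongr
    have := pow_le_pow_left₀ (norm_nonneg _) (key.trans h1) 2
    rw [Real.norm_eq_abs, sq_abs] at this
    have h2 : 0 ≤ ε ^ 2 * ‖y - x‖ ^ 2 := by positivity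
    calc _ ≤ _ := this
      _ = (2 * M / δ) ^ 2 * ‖y - x‖ ^ 4 := by ring
      _ ≤ _ := by linarith

lemma pi_norm_sq_le_sum {ι : Type*} [Fintype ι] (d : ι → ℝ) : ‖d‖ ^ 2 ≤ ∑ i, d i ^ 2 := by
  have h0 : 0 ≤ ∑ i, d i ^ 2 := Finset.sum_nonneg fun i _ => sq_nonneg _
  refine (Real.le_sqrt (norm_nonneg _) h0).1
    ((pi_norm_le_iff_of_nonneg (Real.sqrt_nonneg _)).2 fun i => ?_)
  exact Real.abs_le_sqrt (Finset.single_le_sum (f := fun i => d i ^ 2)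
    (fun i _ => sq_nonneg _) (Finset.mem_univ i))

lemma pi_norm_pow_four_le_sum {ι : Type*} [Fintype ι] (d : ι → ℝ) :
    ‖d‖ ^ 4 ≤ Fintype.card ι * ∑ i, d i ^ 4 := by
  calc ‖d‖ ^ 4 = (‖d‖ ^ 2) ^ 2 := by ring
    _ ≤ (∑ i, d i ^ 2) ^ 2 := pow_le_pow_left₀ (by positivity) (pi_norm_sq_le_sum d) 2
    _ ≤ Fintype.card ι * ∑ i, (d i ^ 2) ^ 2 := sq_sum_le_card_mul_sum_sq
    _ = _ := by simp only [← pow_mul]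

lemma fderiv_apply_eq_sum {ι : Type*} [Fintype ι] [DecidableEq ι] (T : (ι → ℝ) →L[ℝ] ℝ)
    (d : ι → ℝ) : T d = ∑ i, T (Pi.single i 1) * d i := by
  have : d = ∑ i, d i • (Pi.single i 1 : ι → ℝ) := by
    ext j
    simp [Finset.sum_apply, Pi.single_apply]
  conv_lhs => rw [this]
  simp [map_sum, mul_comm]

/-- Stone–Weierstrass on the cube K containing the range of (f_i): the functions on K whose pullback
to E lies in S form a subalgebra that contains the coordinates, and these separate points. -/
lemma Subalgebra.exists_near_continuous_comp {E ι : Type*} [Fintype ι]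
    {S : Subalgebra ℝ (E → ℝ)} {f : ι → E → ℝ} (hf : ∀ i, f i ∈ S) {R : ℝ}
    (hR : ∀ i x, |f i x| ≤ R) {G : (ι → ℝ) → ℝ} (hG : Continuous G) {η : ℝ} (hη : 0 < η) :
    ∃ h ∈ S, ∀ x, |G (fun i => f i x) - h x| ≤ η := by
  let K : Set (ι → ℝ) := Set.univ.pi fun _ => Set.Icc (-R) R
  have : CompactSpace K :=
    isCompact_iff_compactSpace.1 (isCompact_univ_pi fun _ => isCompact_Icc)
  let T : E → K := fun x => ⟨fun i => f i x, fun i _ => abs_le.1 (hR i x)⟩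
  let Θ : C(K, ℝ) →ₐ[ℝ] (E → ℝ) :=
    { toFun := fun g x => g (T x)
      map_one' := rfl
      map_mul' := fun _ _ => rfl
      map_zero' := rfl
      map_add' := fun _ _ => rfl
      commutes' := fun _ => rfl }
  obtain ⟨g, hg⟩ := ContinuousMap.exists_mem_subalgebra_near_continuousMap_of_separatesPoints
    (S.comap Θ) (fun x y hxy => by
      obtain ⟨i, hi⟩ := Function.ne_iff.1 (fun h => hxy (Subtype.ext h))
      refine ⟨_, ⟨⟨fun z : K => z.1 i, (continuous_apply i).comp continuous_subtype_val⟩, ?_, rfl⟩, hi⟩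
      exact hf i) ⟨fun z : K => G z.1, by fun_prop⟩ η hη
  refine ⟨Θ g, g.2, fun x => ?_⟩
  rw [ContinuousMap.norm_lt_iff _ hη] at hg
  have := hg (T x)
  rw [ContinuousMap.sub_apply, norm_sub_rev] at this
  exact this.le

/-! ### Locality and the fourth moments of the increments. -/

namespace IsLimitAlgebra

variable {Ω E : Type*} [MeasurableSpace Ω] [MeasurableSpace E] {P : Measure Ω}
  [IsProbabilityMeasure P] {Y : Ω → E} {Yn : ℕ → Ω → E} {α : ℕ → ℝ} {S : Subalgebra ℝ (E → ℝ)}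
  {A : (E → ℝ) → E → ℝ} {φ χ ψ f g h u : E → ℝ}

lemma abs_mul_integral_le (H : IsLimitAlgebra P Y Yn α S A) (n : ℕ) {V W : Ω → ℝ}
    (hW : IsBoundedMeasurable W) (hle : ∀ s, |V s| ≤ W s) :
    |α n * ∫ s, V s ∂P| ≤ α n * ∫ s, W s ∂P := by
  rw [abs_mul, abs_of_pos (H.pos n)]
  exact mul_le_mul_of_nonneg_left
    (norm_integral_le_of_norm_le (f := V) (hW.integrable P) (Eventually.of_forall hle))
    (H.pos n).le

lemma mul_integral_sq_increment (n : ℕ) :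
    α n * ∫ s, (f (Yn n s) - f (Y s)) ^ 2 ∂P = 2 * approxForm P Y Yn α n f f := by
  simp only [approxForm, sq]
  ring

/-- Take bumps G at x and K at y with outer radius 3r/2; their supports are disjoint since 3r < 4r =
|x - y|. As GK = 0, the product of the increments of G ∘ f and K ∘ f is -G(f(Y)) K(f(Y_n)) -
G(f(Y_n)) K(f(Y)), at most minus the indicator of the event. So the quantity is at most -2 times the
approximate form, which tends to 0 by locality. -/
lemma tendsto_measureReal_prod_closedBall (H : IsLimitAlgebra P Y Yn α S A) (hf : f ∈ S)
    {r : ℝ} (hr : 0 < r) {x y : ℝ} (hxy : 4 * r = |x - y|)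
    (hlocal : IsLocalForm (closureDomain (P.map Y) S (preLimitForm P Y Yn α))
      (closureForm (P.map Y) S (preLimitForm P Y Yn α))) :
    Tendsto (fun n => α n * P.real {s | (f (Y s), f (Yn n s)) ∈
      Metric.closedBall x r ×ˢ Metric.closedBall y r}) atTop (𝓝 0) := by
  let G : ContDiffBump x := ⟨r, 3 / 2 * r, hr, by linarith⟩
  let K : ContDiffBump y := ⟨r, 3 / 2 * r, hr, by linarith⟩
  have hdisj : Disjoint (tsupport G) (tsupport K) := by
    rw [G.tsupport_eq, K.tsupport_eq]
    refine Metric.closedBall_disjoint_closedBall ?_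
    rw [Real.dist_eq, ← hxy]
    change 3 / 2 * r + 3 / 2 * r < 4 * r
    linarith
  have hzero : ∀ z, G z * K z = 0 := fun z => by
    by_contra hne
    obtain ⟨h1, h2⟩ := mul_ne_zero_iff.1 hne
    exact Set.disjoint_left.1 hdisj (subset_tsupport _ h1) (subset_tsupport _ h2)
  have hlim := H.tendsto_approxForm_comp hf (G := G) (K := K) G.contDiff K.contDiff
  rw [hlocal f (H.mem_closureDomain hf) G K G.contDiff K.contDiff G.hasCompactSupport
    K.hasCompactSupport hdisj] at hlim
  have hlim' := hlim.const_mul (-2)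
  rw [mul_zero] at hlim'
  refine tendsto_of_tendsto_of_tendsto_of_le_of_le tendsto_const_nhds hlim'
    (fun n => mul_nonneg (H.pos n).le measureReal_nonneg) fun n => ?_
  have hfb := H.bounded f hf
  have hGf : IsBoundedMeasurable (fun x => G (f x)) := hfb.continuous_comp G.continuous
  have hKf : IsBoundedMeasurable (fun x => K (f x)) := hfb.continuous_comp K.continuous
  set U := {s | (f (Y s), f (Yn n s)) ∈ Metric.closedBall x r ×ˢ Metric.closedBall y r}
  have hU : MeasurableSet U :=
    ((hfb.measurable.comp H.measurable_left).prodMk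
      (hfb.measurable.comp (H.measurable_right n)))
      (Metric.isClosed_closedBall.prod Metric.isClosed_closedBall).measurableSet
  have hind : IsBoundedMeasurable (U.indicator (1 : Ω → ℝ)) :=
    ⟨measurable_one.indicator hU, 1, zero_le_one, fun s => by
      by_cases hs : s ∈ U <;> simp [hs]⟩
  have key := H.mul_integral_mono n hind ((IsBoundedMeasurable.const (-1)).mul
    ((H.increment hGf n).mul (H.increment hKf n))) fun s => by
      have h1 := hzero (f (Y s))
      have h2 := hzero (f (Yn n s))
      have h3 : 0 ≤ G (f (Yn n s)) * K (f (Y s)) := mul_nonneg G.nonneg K.nonneg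
      have h4 : U.indicator (1 : Ω → ℝ) s ≤ G (f (Y s)) * K (f (Yn n s)) := by
        by_cases hs : s ∈ U
        · rw [Set.indicator_of_mem hs, G.one_of_mem_closedBall hs.1,
            K.one_of_mem_closedBall hs.2, mul_one, Pi.one_apply]
        · rw [Set.indicator_of_notMem hs]
          exact mul_nonneg G.nonneg K.nonneg
      linear_combination h4 + h3 + h1 + h2
  rw [integral_indicator_one hU, integral_const_mul] at key
  refine key.trans (le_of_eq ?_)
  simp only [approxForm, Function.comp_apply]
  ring

/-- Locality forces the fourth moments of the increments to vanish in the limit. -/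
lemma tendsto_fourth_moment (H : IsLimitAlgebra P Y Yn α S A) (hf : f ∈ S)
    (hlocal : IsLocalForm (closureDomain (P.map Y) S (preLimitForm P Y Yn α))
      (closureForm (P.map Y) S (preLimitForm P Y Yn α))) :
    Tendsto (fun n => α n * ∫ s, (f (Yn n s) - f (Y s)) ^ 4 ∂P) atTop (𝓝 0) := by
  have hfb := H.bounded f hf
  obtain ⟨R, hR0, hR⟩ := hfb.bounded
  obtain ⟨C, hC0, hC⟩ := H.exists_approxForm_bound hf
  refine tendsto_zero_of_forall_abs_le fun η hη => ?_
  -- Jumps smaller than δ contribute at most δ² α_n E[(Δf)²] ≤ δ² · 2C = η.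
  obtain ⟨δ, hδ, hδη⟩ : ∃ δ : ℝ, 0 < δ ∧ δ ^ 2 * (2 * C) = η :=
    ⟨Real.sqrt (η / (2 * C)), Real.sqrt_pos.2 (by positivity), by
      rw [Real.sq_sqrt (by positivity)]; field_simp⟩
  set K : Set (ℝ × ℝ) := (Metric.closedBall 0 R ×ˢ Metric.closedBall 0 R) ∩
    {z | δ ≤ |z.1 - z.2|} with hKdef
  have hK : IsCompact K := ((isCompact_closedBall _ _).prod (isCompact_closedBall _ _)).inter_right
    (isClosed_le continuous_const (by fun_prop))
  have hprob : Tendsto (fun n => α n * P.real {s | (f (Y s), f (Yn n s)) ∈ K})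
      atTop (𝓝 0) := by
    -- The off-diagonal set K is compact, hence covered by finitely many products of balls as in
    -- `tendsto_measureReal_prod_closedBall`.
    refine hK.induction_on (p := fun U => Tendsto
      (fun n => α n * P.real {s | (f (Y s), f (Yn n s)) ∈ U}) atTop (𝓝 0)) (by simp)
      (fun U V hUV hV => ?_) (fun U V hU hV => ?_) fun z hz => ?_
    · refine tendsto_of_tendsto_of_tendsto_of_le_of_le tendsto_const_nhds hV
        (fun n => mul_nonneg (H.pos n).le measureReal_nonneg) fun n => ?_
      exact mul_le_mul_of_nonneg_left (measureReal_mono fun s hs => hUV hs) (H.pos n).le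
    · have := hU.add hV
      rw [add_zero] at this
      refine tendsto_of_tendsto_of_tendsto_of_le_of_le tendsto_const_nhds this
        (fun n => mul_nonneg (H.pos n).le measureReal_nonneg) fun n => ?_
      simp only
      rw [← mul_add]
      exact mul_le_mul_of_nonneg_left (measureReal_union_le _ _) (H.pos n).le
    · have hz' : 0 < |z.1 - z.2| := hδ.trans_le hz.2
      refine ⟨Metric.closedBall z.1 (|z.1 - z.2| / 4) ×ˢ Metric.closedBall z.2 (|z.1 - z.2| / 4),
        mem_nhdsWithin_of_mem_nhds (prod_mem_nhds (Metric.closedBall_mem_nhds _ (by positivity))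
          (Metric.closedBall_mem_nhds _ (by positivity))), ?_⟩
      exact H.tendsto_measureReal_prod_closedBall hf (by positivity) (by ring) hlocal
  refine ⟨fun n => (2 * R) ^ 4 * (α n * P.real {s | (f (Y s), f (Yn n s)) ∈ K}),
    by simpa using hprob.const_mul ((2 * R) ^ 4), fun n => ?_⟩
  set U := {s | (f (Y s), f (Yn n s)) ∈ K} with hUdef
  have hU : MeasurableSet U :=
    ((hfb.measurable.comp H.measurable_left).prodMk
      (hfb.measurable.comp (H.measurable_right n))) hK.isClosed.measurableSet
  have hind : IsBoundedMeasurable (U.indicator (1 : Ω → ℝ)) :=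
    ⟨measurable_one.indicator hU, 1, zero_le_one, fun s => by
      by_cases hs : s ∈ U <;> simp [hs]⟩
  have h1 := (IsBoundedMeasurable.const (δ ^ 2)).mul ((H.increment hfb n).pow 2)
  have h2 := (IsBoundedMeasurable.const ((2 * R) ^ 4)).mul hind
  have key := H.abs_mul_integral_le n (V := fun s => (f (Yn n s) - f (Y s)) ^ 4) (h1.add h2)
    fun s => by
      set d := f (Yn n s) - f (Y s) with hd
      have hdR : |d| ≤ 2 * R := (abs_sub _ _).trans (by linarith [hR (Yn n s), hR (Y s)])
      rw [abs_of_nonneg (by positivity)]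
      by_cases hs : s ∈ U
      · rw [Set.indicator_of_mem hs, Pi.one_apply, mul_one]
        have := pow_le_pow_left₀ (abs_nonneg _) hdR 4
        rw [(show Even 4 by decide).pow_abs] at this
        nlinarith [mul_nonneg (sq_nonneg δ) (sq_nonneg d)]
      · rw [Set.indicator_of_notMem hs, mul_zero, add_zero]
        have hdδ : |d| ≤ δ := by
          by_contra hlt
          refine hs ⟨⟨by simpa using hR (Y s), by simpa using hR (Yn n s)⟩, ?_⟩
          change δ ≤ |f (Y s) - f (Yn n s)|
          rw [abs_sub_comm]
          exact (not_le.1 hlt).le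
        have := pow_le_pow_left₀ (abs_nonneg _) hdδ 2
        rw [sq_abs] at this
        calc d ^ 4 = d ^ 2 * d ^ 2 := by ring
          _ ≤ δ ^ 2 * d ^ 2 := mul_le_mul_of_nonneg_right this (sq_nonneg d)
  rw [integral_add (h1.integrable P) (h2.integrable P), integral_const_mul, integral_const_mul,
    integral_indicator_one hU, mul_add, mul_left_comm, mul_integral_sq_increment,
    mul_left_comm] at key
  have h3 : δ ^ 2 * (2 * approxForm P Y Yn α n f f) ≤ η := by
    rw [← hδη]
    have := hC n
    gcongr
  linarith

/-! ### Limits of weighted covariations of the increments. -/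

/-- The symmetrized weighted covariation of the increments converges. -/
lemma tendsto_symmetrized (H : IsLimitAlgebra P Y Yn α S A) (hf : f ∈ S) (hg : g ∈ S)
    (hh : h ∈ S) :
    Tendsto (fun n => α n / 2 * ∫ s, (h (Y s) + h (Yn n s)) *
      ((f (Yn n s) - f (Y s)) * (g (Yn n s) - g (Y s))) ∂P) atTop
      (𝓝 (∫ x, h x * squareField A f g x ∂(P.map Y))) := by
  rw [H.integral_mul_squareField hf hg (H.isRepresentedForm.memLp h hh)]
  have h1 := H.tendsto _ hg _ (S.mul_mem hf hh)
  have h2 := H.tendsto _ hf _ (S.mul_mem hg hh)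
  have h3 := H.tendsto _ (S.mul_mem hf hg) _ hh
  -- Δg Δ(fh) + Δf Δ(gh) - Δ(fg) Δh = (h(Y) + h(Y_n)) Δf Δg.
  refine ((h1.add h2).sub h3).congr fun n => ?_
  have b1 := (H.increment (H.bounded _ hg) n).mul (H.increment (H.bounded _ (S.mul_mem hf hh)) n)
  have b2 := (H.increment (H.bounded _ hf) n).mul (H.increment (H.bounded _ (S.mul_mem hg hh)) n)
  have b3 := (H.increment (H.bounded _ (S.mul_mem hf hg)) n).mul (H.increment (H.bounded _ hh) n)
  simp only [approxForm]
  rw [← mul_add, ← mul_sub, ← integral_add (b1.integrable P) (b2.integrable P),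
    ← integral_sub ((b1.add b2).integrable P) (b3.integrable P)]
  congr 2
  ext s
  simp only [Pi.mul_apply]
  ring

/-- The weight h(Y) is the symmetric one minus Δh/2. The remaining third order term is negligible by
|Δh Δf Δg| ≤ ρ (Δh)² + ρ⁻¹ ((Δf)⁴ + (Δg)⁴): second moments stay bounded, fourth moments vanish, and
ρ is arbitrary. -/
lemma tendsto_weighted (H : IsLimitAlgebra P Y Yn α S A) (hf : f ∈ S) (hg : g ∈ S)
    (hh : h ∈ S)
    (hlocal : IsLocalForm (closureDomain (P.map Y) S (preLimitForm P Y Yn α))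
      (closureForm (P.map Y) S (preLimitForm P Y Yn α))) :
    Tendsto (fun n => α n * ∫ s, h (Y s) *
      ((f (Yn n s) - f (Y s)) * (g (Yn n s) - g (Y s))) ∂P) atTop
      (𝓝 (∫ x, h x * squareField A f g x ∂(P.map Y))) := by
  obtain ⟨C, hC0, hC⟩ := H.exists_approxForm_bound hh
  have hzero : Tendsto (fun n => α n * ∫ s, (h (Yn n s) - h (Y s)) *
      ((f (Yn n s) - f (Y s)) * (g (Yn n s) - g (Y s))) ∂P) atTop (𝓝 0) := by
    refine tendsto_zero_of_forall_abs_le fun η hη => ?_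
    obtain ⟨ρ, hρ, hρη⟩ : ∃ ρ : ℝ, 0 < ρ ∧ ρ * (2 * C) = η :=
      ⟨η / (2 * C), by positivity, by field_simp⟩
    refine ⟨fun n => ρ⁻¹ * (α n * ∫ s, (f (Yn n s) - f (Y s)) ^ 4 ∂P +
        α n * ∫ s, (g (Yn n s) - g (Y s)) ^ 4 ∂P), ?_, fun n => ?_⟩
    · simpa using ((H.tendsto_fourth_moment hf hlocal).add
        (H.tendsto_fourth_moment hg hlocal)).const_mul ρ⁻¹
    have b1 := (IsBoundedMeasurable.const ρ).mul ((H.increment (H.bounded h hh) n).pow 2)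
    have b2 := (H.increment (H.bounded f hf) n).pow 4
    have b3 := (H.increment (H.bounded g hg) n).pow 4
    have b4 := (IsBoundedMeasurable.const ρ⁻¹).mul (b2.add b3)
    have key := H.abs_mul_integral_le n (V := fun s => (h (Yn n s) - h (Y s)) *
      ((f (Yn n s) - f (Y s)) * (g (Yn n s) - g (Y s)))) (b1.add b4) fun s => by
        set a := h (Yn n s) - h (Y s)
        set b := f (Yn n s) - f (Y s)
        set c := g (Yn n s) - g (Y s)
        have e1 : |a| * |b * c| ≤ ρ * a ^ 2 + ρ⁻¹ * (b * c) ^ 2 := by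
          rw [← sq_abs a, ← sq_abs (b * c)]
          have hs := sq_nonneg (ρ * |a| - |b * c|)
          have hp : 0 ≤ |a| * |b * c| := by positivity
          have : ρ * (|a| * |b * c|) ≤ ρ * (ρ * |a| ^ 2 + ρ⁻¹ * |b * c| ^ 2) := by
            rw [mul_add, mul_inv_cancel_left₀ hρ.ne']
            nlinarith
          exact le_of_mul_le_mul_left this hρ
        have e2 : (b * c) ^ 2 ≤ b ^ 4 + c ^ 4 := by
          nlinarith [sq_nonneg (b ^ 2 - c ^ 2), sq_nonneg (b ^ 2), sq_nonneg (c ^ 2)]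
        rw [abs_mul]
        exact e1.trans (by gcongr)
    rw [integral_add (b1.integrable P) (b4.integrable P), integral_const_mul,
      integral_const_mul, integral_add (b2.integrable P) (b3.integrable P), mul_add,
      mul_left_comm, mul_integral_sq_increment, mul_left_comm (α n) ρ⁻¹, mul_add (α n)] at key
    have : ρ * (2 * approxForm P Y Yn α n h h) ≤ η := by
      rw [← hρη]
      have := hC n
      gcongr
    linarith
  have := (H.tendsto_symmetrized hf hg hh).sub (hzero.const_mul (1 / 2))
  rw [mul_zero, sub_zero] at this
  refine this.congr fun n => ?_
  have bfg := (H.increment (H.bounded _ hf) n).mul (H.increment (H.bounded _ hg) n)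
  have b1 := (((H.bounded h hh).comp H.measurable_left).add
    ((H.bounded h hh).comp (H.measurable_right n))).mul bfg
  have b2 := (H.increment (H.bounded h hh) n).mul bfg
  rw [← mul_assoc, one_div_mul_eq_div, ← mul_sub,
    ← integral_sub (b1.integrable P) (b2.integrable P), div_mul_eq_mul_div, mul_div_assoc,
    ← integral_div]
  congr 2
  ext s
  ring

/-- Meant for the weights F'_i F'_j evaluated at (f_1, …, f_p), which are only uniform limits of
members of the algebra. The approximation error is uniform in n because |Δf Δg| ≤ (Δf)² + (Δg)² has
bounded scaled expectation. -/
lemma tendsto_weighted_continuous (H : IsLimitAlgebra P Y Yn α S A) (hf : f ∈ S) (hg : g ∈ S)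
    {ι : Type*} [Fintype ι] {k : ι → E → ℝ} (hk : ∀ i, k i ∈ S) {G : (ι → ℝ) → ℝ}
    (hG : Continuous G)
    (hlocal : IsLocalForm (closureDomain (P.map Y) S (preLimitForm P Y Yn α))
      (closureForm (P.map Y) S (preLimitForm P Y Yn α))) :
    Tendsto (fun n => α n * ∫ s, G (fun i => k i (Y s)) *
      ((f (Yn n s) - f (Y s)) * (g (Yn n s) - g (Y s))) ∂P) atTop
      (𝓝 (∫ x, G (fun i => k i x) * squareField A f g x ∂(P.map Y))) := by
  have := H.isProbabilityMeasure_map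
  choose B hB0 hB using fun i => (H.bounded _ (hk i)).bounded
  have hR : ∀ i x, |k i x| ≤ ∑ i, B i := fun i x =>
    (hB i x).trans (Finset.single_le_sum (fun i _ => hB0 i) (Finset.mem_univ i))
  obtain ⟨C, hC0, hC⟩ := H.exists_approxForm_bound hf
  obtain ⟨C', hC0', hC'⟩ := H.exists_approxForm_bound hg
  have hΓ : Integrable (squareField A f g) (P.map Y) :=
    (H.memLp_squareField hf hg).integrable (by norm_num)
  set D := ∫ x, |squareField A f g x| ∂(P.map Y)
  have hD : 0 ≤ D := integral_nonneg fun _ => abs_nonneg _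
  rw [← tendsto_sub_nhds_zero_iff]
  refine tendsto_zero_of_forall_abs_le fun η hη => ?_
  -- 2C and 2C' pay for the change of weight before the limit, D for the change in the limiting
  -- integral.
  obtain ⟨ρ, hρ, hρη⟩ : ∃ ρ : ℝ, 0 < ρ ∧ ρ * (2 * C + 2 * C' + D) = η :=
    ⟨η / (2 * C + 2 * C' + D), by positivity, by field_simp⟩
  obtain ⟨h, hh, hGh⟩ := Subalgebra.exists_near_continuous_comp hk hR hG hρ
  have hlim := tendsto_sub_nhds_zero_iff.2 (H.tendsto_weighted hf hg hh hlocal)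
  rw [tendsto_zero_iff_abs_tendsto_zero] at hlim
  refine ⟨_, hlim, fun n => ?_⟩
  have bG : IsBoundedMeasurable fun x => G fun i => k i x :=
    IsBoundedMeasurable.continuous_comp_pi (fun i => H.bounded _ (hk i)) hG
  have bfg := (H.increment (H.bounded _ hf) n).mul (H.increment (H.bounded _ hg) n)
  have b1 := (bG.comp H.measurable_left).mul bfg
  have b2 := ((H.bounded h hh).comp H.measurable_left).mul bfg
  have bf := (H.increment (H.bounded _ hf) n).pow 2
  have bg := (H.increment (H.bounded _ hg) n).pow 2
  have key := H.abs_mul_integral_le n (V := fun s => G (fun i => k i (Y s)) *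
      ((f (Yn n s) - f (Y s)) * (g (Yn n s) - g (Y s))) - h (Y s) *
      ((f (Yn n s) - f (Y s)) * (g (Yn n s) - g (Y s))))
    ((IsBoundedMeasurable.const ρ).mul (bf.add bg)) fun s => by
      rw [← sub_mul, abs_mul]
      refine mul_le_mul (hGh _) ?_ (abs_nonneg _) hρ.le
      rw [abs_le]
      constructor <;> nlinarith [sq_nonneg (f (Yn n s) - f (Y s) - (g (Yn n s) - g (Y s))),
        sq_nonneg (f (Yn n s) - f (Y s) + (g (Yn n s) - g (Y s)))]
  rw [integral_sub (b1.integrable P) (b2.integrable P), integral_const_mul,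
    integral_add (bf.integrable P) (bg.integrable P), mul_left_comm, mul_add (α n),
    mul_integral_sq_increment, mul_integral_sq_increment, mul_sub] at key
  have i1 : Integrable (fun x => G (fun i => k i x) * squareField A f g x) (P.map Y) := by
    obtain ⟨M, -, hM⟩ := bG.bounded
    exact hΓ.bdd_mul bG.measurable.aestronglyMeasurable (Eventually.of_forall hM)
  have i2 : Integrable (fun x => h x * squareField A f g x) (P.map Y) := by
    obtain ⟨M, -, hM⟩ := (H.bounded h hh).bounded
    exact hΓ.bdd_mul (H.bounded h hh).measurable.aestronglyMeasurable (Eventually.of_forall hM)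
  have key' : |∫ x, h x * squareField A f g x ∂(P.map Y) -
      ∫ x, G (fun i => k i x) * squareField A f g x ∂(P.map Y)| ≤ ρ * D := by
    rw [← integral_sub i2 i1, ← integral_const_mul]
    refine norm_integral_le_of_norm_le (f := fun x => h x * squareField A f g x -
      G (fun i => k i x) * squareField A f g x) (hΓ.abs.const_mul ρ)
      (Eventually.of_forall fun x => ?_)
    rw [← sub_mul, norm_mul, norm_sub_rev]
    exact mul_le_mul_of_nonneg_right (hGh x) (abs_nonneg _)
  have hb : ρ * (2 * approxForm P Y Yn α n f f + 2 * approxForm P Y Yn α n g g) + ρ * D ≤ η := by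
    rw [← hρη, ← mul_add]
    have := hC n
    have := hC' n
    gcongr
  calc _ = |(α n * ∫ s, G (fun i => k i (Y s)) *
        ((f (Yn n s) - f (Y s)) * (g (Yn n s) - g (Y s))) ∂P - α n * ∫ s, h (Y s) *
        ((f (Yn n s) - f (Y s)) * (g (Yn n s) - g (Y s))) ∂P) +
        (∫ x, h x * squareField A f g x ∂(P.map Y) -
          ∫ x, G (fun i => k i x) * squareField A f g x ∂(P.map Y)) +
        (α n * ∫ s, h (Y s) * ((f (Yn n s) - f (Y s)) * (g (Yn n s) - g (Y s))) ∂P -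
          ∫ x, h x * squareField A f g x ∂(P.map Y))| := by ring_nf
    _ ≤ _ := abs_add_three _ _ _
    _ ≤ _ := by simp only [Function.comp_apply]; linarith

end IsLimitAlgebra

/-! ### The functional calculus for C¹ functions of several members of the algebra. -/

namespace IsLimitAlgebra

variable {Ω E : Type*} [MeasurableSpace Ω] [MeasurableSpace E] {P : Measure Ω}
  [IsProbabilityMeasure P] {Y : Ω → E} {Yn : ℕ → Ω → E} {α : ℕ → ℝ} {S : Subalgebra ℝ (E → ℝ)}
  {A : (E → ℝ) → E → ℝ} {ι : Type*} [Fintype ι] [DecidableEq ι] {F : (ι → ℝ) → ℝ}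
  {f : ι → E → ℝ}

/-- The linear part of the increment of `F(f₁, …, f_p)` has the announced limit. -/
lemma tendsto_linear_part (H : IsLimitAlgebra P Y Yn α S A) (hF : ContDiff ℝ 1 F)
    (hf : ∀ i, f i ∈ S)
    (hlocal : IsLocalForm (closureDomain (P.map Y) S (preLimitForm P Y Yn α))
      (closureForm (P.map Y) S (preLimitForm P Y Yn α))) :
    Tendsto (fun n => α n * ∫ s, (∑ i, fderiv ℝ F (fun k => f k (Y s)) (Pi.single i 1) *
        (f i (Yn n s) - f i (Y s))) ^ 2 ∂P) atTop
      (𝓝 (∫ x, ∑ i, ∑ j, fderiv ℝ F (fun k => f k x) (Pi.single i 1) *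
        fderiv ℝ F (fun k => f k x) (Pi.single j 1) * squareField A (f i) (f j) x ∂(P.map Y))) := by
  have := H.isProbabilityMeasure_map
  have hG : ∀ i j : ι, Continuous fun v => fderiv ℝ F v (Pi.single i 1) *
      fderiv ℝ F v (Pi.single j 1) := fun i j =>
    ((hF.continuous_fderiv one_ne_zero).clm_apply continuous_const).mul
      ((hF.continuous_fderiv one_ne_zero).clm_apply continuous_const)
  have hint : ∀ i j, Integrable (fun x => fderiv ℝ F (fun k => f k x) (Pi.single i 1) *
      fderiv ℝ F (fun k => f k x) (Pi.single j 1) * squareField A (f i) (f j) x)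
      (P.map Y) := fun i j => by
    have bG := IsBoundedMeasurable.continuous_comp_pi (fun i => H.bounded _ (hf i)) (hG i j)
    obtain ⟨M, -, hM⟩ := bG.bounded
    exact ((H.memLp_squareField (hf i) (hf j)).integrable (by norm_num)).bdd_mul
      bG.measurable.aestronglyMeasurable (Eventually.of_forall hM)
  rw [integral_finsetSum _ fun i _ => integrable_finsetSum _ fun j _ => hint i j]
  simp_rw [fun i => integral_finsetSum Finset.univ fun j _ => hint i j]
  refine (tendsto_finsetSum _ fun i _ => tendsto_finsetSum _ fun j _ =>
    H.tendsto_weighted_continuous (hf i) (hf j) hf (hG i j) hlocal).congr fun n => ?_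
  have hint' : ∀ i j, Integrable (fun s => fderiv ℝ F (fun k => f k (Y s)) (Pi.single i 1) *
      fderiv ℝ F (fun k => f k (Y s)) (Pi.single j 1) *
      ((f i (Yn n s) - f i (Y s)) * (f j (Yn n s) - f j (Y s)))) P := fun i j =>
    (((IsBoundedMeasurable.continuous_comp_pi (fun i => H.bounded _ (hf i)) (hG i j)).comp
      H.measurable_left).mul ((H.increment (H.bounded _ (hf i)) n).mul
        (H.increment (H.bounded _ (hf j)) n))).integrable P
  simp_rw [← Finset.mul_sum]
  simp_rw [fun i => (integral_finsetSum Finset.univ fun j _ => hint' i j).symm]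
  rw [← integral_finsetSum _ fun i _ => integrable_finsetSum _ fun j _ => hint' i j]
  congr 2
  ext s
  rw [sq, Finset.sum_mul_sum]
  refine Finset.sum_congr rfl fun i _ => Finset.sum_congr rfl fun j _ => ?_
  ring

lemma isBoundedMeasurable_linear_part (H : IsLimitAlgebra P Y Yn α S A)
    (hF : ContDiff ℝ 1 F) (hf : ∀ i, f i ∈ S) (n : ℕ) :
    IsBoundedMeasurable fun s => ∑ i, fderiv ℝ F (fun k => f k (Y s)) (Pi.single i 1) *
      (f i (Yn n s) - f i (Y s)) :=
  IsBoundedMeasurable.sum fun i =>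
    ((IsBoundedMeasurable.continuous_comp_pi (fun i => H.bounded _ (hf i))
      (G := fun v => fderiv ℝ F v (Pi.single i 1))
      ((hF.continuous_fderiv one_ne_zero).clm_apply continuous_const)).comp
        H.measurable_left).mul (H.increment (H.bounded _ (hf i)) n)

lemma isBoundedMeasurable_comp (H : IsLimitAlgebra P Y Yn α S A)
    (hF : ContDiff ℝ 1 F) (hf : ∀ i, f i ∈ S) :
    IsBoundedMeasurable fun x => F fun i => f i x :=
  IsBoundedMeasurable.continuous_comp_pi (fun i => H.bounded _ (hf i)) hF.continuous

/-- The nonlinear part of the increment of `F(f₁, …, f_p)` is negligible. -/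
lemma tendsto_remainder (H : IsLimitAlgebra P Y Yn α S A) (hF : ContDiff ℝ 1 F)
    (hf : ∀ i, f i ∈ S)
    (hlocal : IsLocalForm (closureDomain (P.map Y) S (preLimitForm P Y Yn α))
      (closureForm (P.map Y) S (preLimitForm P Y Yn α))) :
    Tendsto (fun n => α n * ∫ s, (F (fun i => f i (Yn n s)) - F (fun i => f i (Y s)) -
      ∑ i, fderiv ℝ F (fun k => f k (Y s)) (Pi.single i 1) *
        (f i (Yn n s) - f i (Y s))) ^ 2 ∂P) atTop (𝓝 0) := by
  choose B hB0 hB using fun i => (H.bounded _ (hf i)).bounded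
  have hR : ∀ x, ‖fun i => f i x‖ ≤ ∑ i, B i := fun x =>
    (pi_norm_le_iff_of_nonneg (Finset.sum_nonneg fun i _ => hB0 i)).2 fun i =>
      (hB i x).trans (Finset.single_le_sum (fun i _ => hB0 i) (Finset.mem_univ i))
  choose C hC0 hC using fun i => H.exists_approxForm_bound (hf i)
  have hCs : 0 ≤ ∑ i, C i := Finset.sum_nonneg fun i _ => (hC0 i).le
  refine tendsto_zero_of_forall_abs_le fun η hη => ?_
  -- The quadratic part of the Taylor remainder costs ε² · 2 ∑ C_i, while the quartic part vanishes
  -- with n. The `+ 1` keeps the denominator positive when the index type is empty.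
  obtain ⟨ε, hε, hεη⟩ : ∃ ε : ℝ, 0 < ε ∧ ε ^ 2 * (2 * ∑ i, C i + 1) = η :=
    ⟨Real.sqrt (η / (2 * ∑ i, C i + 1)), Real.sqrt_pos.2 (by positivity), by
      rw [Real.sq_sqrt (by positivity)]; field_simp⟩
  obtain ⟨K, hK0, hK⟩ := exists_sq_remainder_le hF (∑ i, B i) hε
  refine ⟨fun n => K * Fintype.card ι * ∑ i, α n * ∫ s, (f i (Yn n s) - f i (Y s)) ^ 4 ∂P,
    ?_, fun n => ?_⟩
  · have := (tendsto_finsetSum Finset.univ fun i _ =>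
      H.tendsto_fourth_moment (hf i) hlocal).const_mul (K * Fintype.card ι)
    simpa using this
  have b2 : ∀ i, IsBoundedMeasurable fun s => (f i (Yn n s) - f i (Y s)) ^ 2 := fun i =>
    (H.increment (H.bounded _ (hf i)) n).pow 2
  have b4 : ∀ i, IsBoundedMeasurable fun s => (f i (Yn n s) - f i (Y s)) ^ 4 := fun i =>
    (H.increment (H.bounded _ (hf i)) n).pow 4
  have s2 := (IsBoundedMeasurable.const (ε ^ 2)).mul
    (IsBoundedMeasurable.sum (s := Finset.univ) b2)
  have s4 := (IsBoundedMeasurable.const (K * Fintype.card ι)).mul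
    (IsBoundedMeasurable.sum (s := Finset.univ) b4)
  have key := H.abs_mul_integral_le n
    (V := fun s => (F (fun i => f i (Yn n s)) - F (fun i => f i (Y s)) -
      ∑ i, fderiv ℝ F (fun k => f k (Y s)) (Pi.single i 1) *
        (f i (Yn n s) - f i (Y s))) ^ 2) (s2.add s4) fun s => by
      have h1 := hK _ _ (hR (Y s)) (hR (Yn n s))
      rw [fderiv_apply_eq_sum] at h1
      simp only [Pi.sub_apply] at h1
      rw [abs_of_nonneg (sq_nonneg _)]
      refine h1.trans (add_le_add ?_ ?_)
      · exact mul_le_mul_of_nonneg_left (pi_norm_sq_le_sum _) (sq_nonneg _)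
      · rw [mul_assoc]
        exact mul_le_mul_of_nonneg_left (pi_norm_pow_four_le_sum _) hK0
  rw [integral_add (s2.integrable P) (s4.integrable P), integral_const_mul, integral_const_mul,
    integral_finsetSum _ fun i _ => (b2 i).integrable P,
    integral_finsetSum _ fun i _ => (b4 i).integrable P, mul_add, mul_left_comm,
    mul_left_comm (α n) (K * _), Finset.mul_sum _ _ (α n), Finset.mul_sum _ _ (α n)] at key
  simp_rw [mul_integral_sq_increment] at key
  have h2 : ε ^ 2 * ∑ i, 2 * approxForm P Y Yn α n (f i) (f i) ≤ η := by
    rw [← hεη]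
    refine mul_le_mul_of_nonneg_left ?_ (sq_nonneg _)
    rw [← Finset.mul_sum]
    linarith [Finset.sum_le_sum fun i (_ : i ∈ Finset.univ) => hC i n]
  linarith

/-- The second order functional calculus for `C¹` functions of members of the algebra. -/
theorem tendsto_functional_calculus (H : IsLimitAlgebra P Y Yn α S A) (hF : ContDiff ℝ 1 F)
    (hf : ∀ i, f i ∈ S)
    (hlocal : IsLocalForm (closureDomain (P.map Y) S (preLimitForm P Y Yn α))
      (closureForm (P.map Y) S (preLimitForm P Y Yn α))) :
    Tendsto (fun n => α n *
        ∫ s, (F (fun i => f i (Yn n s)) - F (fun i => f i (Y s))) ^ 2 ∂P) atTop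
      (𝓝 (∫ x, ∑ i, ∑ j, fderiv ℝ F (fun k => f k x) (Pi.single i 1) *
        fderiv ℝ F (fun k => f k x) (Pi.single j 1) * squareField A (f i) (f j) x ∂(P.map Y))) := by
  have hlin := H.tendsto_linear_part hF hf hlocal
  have hrem := H.tendsto_remainder hF hf hlocal
  obtain ⟨C, hC⟩ := hlin.bddAbove_range
  have hC1 : 0 < max C 1 := by positivity
  suffices hd : Tendsto (fun n => α n *
        ∫ s, (F (fun i => f i (Yn n s)) - F (fun i => f i (Y s))) ^ 2 ∂P -
      α n * ∫ s, (∑ i, fderiv ℝ F (fun k => f k (Y s)) (Pi.single i 1) *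
        (f i (Yn n s) - f i (Y s))) ^ 2 ∂P) atTop (𝓝 0) by
    simpa using hd.add hlin
  refine tendsto_zero_of_forall_abs_le fun η hη => ?_
  obtain ⟨ρ, hρ, hρη⟩ : ∃ ρ : ℝ, 0 < ρ ∧ ρ * max C 1 = η :=
    ⟨η / max C 1, by positivity, by field_simp⟩
  refine ⟨_, by simpa using hrem.const_mul (1 + ρ⁻¹), fun n => ?_⟩
  have bM := H.isBoundedMeasurable_linear_part hF hf n
  have bF := H.increment (H.isBoundedMeasurable_comp hF hf) n
  have bM2 := (IsBoundedMeasurable.const ρ).mul (bM.pow 2)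
  have bR2 := (IsBoundedMeasurable.const (1 + ρ⁻¹)).mul ((bF.sub bM).pow 2)
  rw [← mul_sub, ← integral_sub ((bF.pow 2).integrable P) ((bM.pow 2).integrable P)]
  have key := H.abs_mul_integral_le n (V := fun s =>
    (F (fun i => f i (Yn n s)) - F (fun i => f i (Y s))) ^ 2 -
      (∑ i, fderiv ℝ F (fun k => f k (Y s)) (Pi.single i 1) *
        (f i (Yn n s) - f i (Y s))) ^ 2) (bM2.add bR2) fun s => by
      set a := F (fun i => f i (Yn n s)) - F (fun i => f i (Y s))
      set m := ∑ i, fderiv ℝ F (fun k => f k (Y s)) (Pi.single i 1) *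
        (f i (Yn n s) - f i (Y s))
      -- With r = a - m one has a² - m² = 2mr + r² and 2|mr| ≤ ρ m² + ρ⁻¹ r²; multiplying by ρ
      -- clears the inverse.
      have h1 : ρ * |a ^ 2 - m ^ 2| ≤ ρ * (ρ * m ^ 2 + (1 + ρ⁻¹) * (a - m) ^ 2) := by
        have e : ρ * (ρ * m ^ 2 + (1 + ρ⁻¹) * (a - m) ^ 2) =
            (ρ * m) ^ 2 + (a - m) ^ 2 + ρ * (a - m) ^ 2 := by
          field_simp
          ring
        rw [e, ← abs_of_pos hρ, ← abs_mul, abs_of_pos hρ, abs_le]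
        constructor
        · nlinarith [sq_nonneg (ρ * m + (a - m)), mul_nonneg hρ.le (sq_nonneg (a - m))]
        · nlinarith [sq_nonneg (ρ * m - (a - m))]
      exact le_of_mul_le_mul_left h1 hρ
  rw [integral_add (bM2.integrable P) (bR2.integrable P), integral_const_mul,
    integral_const_mul, mul_add, mul_left_comm, mul_left_comm (α n) (1 + ρ⁻¹)] at key
  have h2 : ρ * (α n * ∫ s, (∑ i, fderiv ℝ F (fun k => f k (Y s)) (Pi.single i 1) *
        (f i (Yn n s) - f i (Y s))) ^ 2 ∂P) ≤ η := by
    rw [← hρη]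
    exact mul_le_mul_of_nonneg_left ((hC ⟨n, rfl⟩).trans (le_max_left _ _)) hρ.le
  exact key.trans (add_le_add_left h2 _)

end IsLimitAlgebra

/-! ### Reduction of (H3) over `𝕜` to the real algebra. -/

/-- The real-valued members of `D` as a real subalgebra. -/
def realSubalgebra {E 𝕜 : Type*} [RCLike 𝕜] (D : StarSubalgebra 𝕜 (E → 𝕜)) :
    Subalgebra ℝ (E → ℝ) where
  carrier := realMembers D
  mul_mem' {f g} hf hg := by
    have := D.mul_mem hf hg
    simp only [realMembers, Set.mem_ofPred_eq, Pi.mul_apply, RCLike.ofReal_mul]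
    exact this
  add_mem' {f g} hf hg := by
    have := D.add_mem hf hg
    simp only [realMembers, Set.mem_ofPred_eq, Pi.add_apply, RCLike.ofReal_add]
    exact this
  algebraMap_mem' r := D.algebraMap_mem (r : 𝕜)

lemma exists_isLimitAlgebra {Ω E 𝕜 : Type*} [MeasurableSpace Ω] [MeasurableSpace E] [RCLike 𝕜]
    {P : Measure Ω} [IsProbabilityMeasure P] {Y : Ω → E} (hY : Measurable Y)
    {Yn : ℕ → Ω → E} (hYn : ∀ n, Measurable (Yn n)) {α : ℕ → ℝ} (hα : ∀ n, 0 < α n)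
    {D : StarSubalgebra 𝕜 (E → 𝕜)} (hD : IsBoundedDenseAlgebra (P.map Y) D)
    (h3 : HypothesisH3 P Y Yn α D) :
    ∃ A, IsLimitAlgebra P Y Yn α (realSubalgebra D) A := by
  have : IsProbabilityMeasure (P.map Y) := Measure.isProbabilityMeasure_map hY.aemeasurable
  classical
  choose B hB hlim using h3
  have hmeas : ∀ φ ∈ realMembers D, Measurable φ := fun φ hφ => by
    simpa [Function.comp_def] using RCLike.measurable_re.comp (hD.measurable _ hφ)
  -- The real part of the bias represents the form, since φ and χ are real. The default 0 is never
  -- seen: only members of the algebra are tested.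
  refine ⟨fun φ => if hφ : φ ∈ realMembers D then fun x => RCLike.re (B _ hφ x) else 0,
    hY, hYn, hα, fun φ hφ => ⟨hmeas φ hφ, ?_⟩, fun φ hφ => ?_, fun φ hφ χ hχ => ?_⟩
  · obtain ⟨C, hC⟩ := hD.bounded _ hφ
    refine ⟨|C|, abs_nonneg _, fun x => ?_⟩
    have := (hC x).trans (le_abs_self C)
    rwa [RCLike.norm_ofReal] at this
  · rw [dif_pos (show φ ∈ realMembers D from hφ)]
    exact (hB _ hφ).re
  · rw [dif_pos (show φ ∈ realMembers D from hφ)]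
    have hχ2 : MemLp (fun x => (χ x : 𝕜)) 2 (P.map Y) := by
      obtain ⟨C, hC⟩ := hD.bounded _ hχ
      exact MemLp.of_bound (hD.measurable _ hχ).aestronglyMeasurable C (Eventually.of_forall hC)
    have hint : Integrable (fun x => B _ hφ x * (χ x : 𝕜)) (P.map Y) :=
      (hB _ hφ).integrable_mul hχ2
    -- The factor 1/2 turns α_n into α_n/2 and -2 into -1.
    have h1 := ((RCLike.continuous_re.tendsto _).comp (hlim _ hφ _ hχ)).const_mul (1 / 2)
    have e1 : (1 / 2 : ℝ) * RCLike.re (-2 * ∫ x, B _ hφ x * (χ x : 𝕜) ∂(P.map Y)) =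
        -∫ x, RCLike.re (B _ hφ x) * χ x ∂(P.map Y) := by
      have e : (-2 : 𝕜) = ((-2 : ℝ) : 𝕜) := by push_cast; rfl
      rw [e, RCLike.re_ofReal_mul, ← integral_re hint]
      simp only [RCLike.re_mul_ofReal]
      ring
    rw [e1] at h1
    refine h1.congr fun n => ?_
    simp only [Function.comp_apply, ← RCLike.ofReal_sub, ← RCLike.ofReal_mul]
    rw [integral_ofReal, ← RCLike.ofReal_mul, RCLike.ofReal_re, approxForm]
    ring

end

theorem theorem2 {Ω E 𝕜 : Type*} [MeasurableSpace Ω] [MeasurableSpace E] [RCLike 𝕜]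
    (P : Measure Ω) [IsProbabilityMeasure P]
    (Y : Ω → E) (hY : Measurable Y) (Yn : ℕ → Ω → E) (hYn : ∀ n, Measurable (Yn n))
    (α : ℕ → ℝ) (hα : ∀ n, 0 < α n)
    (D : StarSubalgebra 𝕜 (E → 𝕜)) (hD : IsBoundedDenseAlgebra (P.map Y) D)
    (h3 : HypothesisH3 P Y Yn α D)
    (hlocal : IsLocalForm (limitDomain P Y Yn α D) (limitForm P Y Yn α D)) :
    ∃ Γ : (E → ℝ) → (E → ℝ) → E → ℝ,
      (∀ f ∈ realMembers D, ∀ g ∈ realMembers D,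
        IsSquareField (P.map Y) (limitDomain P Y Yn α D) (limitForm P Y Yn α D) f g (Γ f g)) ∧
      ∀ (p : ℕ) (F : (Fin p → ℝ) → ℝ), ContDiff ℝ 1 F →
        ∀ f : Fin p → E → ℝ, (∀ i, f i ∈ realMembers D) →
          Tendsto
            (fun n => α n *
              ∫ s, (F (fun i => f i (Yn n s)) - F (fun i => f i (Y s))) ^ 2 ∂P)
            atTop
            (𝓝 (∫ x, ∑ i, ∑ j,
              fderiv ℝ F (fun k => f k x) (Pi.single i 1) *
                fderiv ℝ F (fun k => f k x) (Pi.single j 1) * Γ (f i) (f j) x ∂(P.map Y))) := by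
  -- `limitDomain` and `limitForm` are by definition the closure over the carrier of `realSubalgebra
  -- D`, so the results for `IsLimitAlgebra` apply as they stand.
  obtain ⟨A, H⟩ := exists_isLimitAlgebra hY hYn hα hD h3
  exact ⟨IsLimitAlgebra.squareField A, fun f hf g hg => H.isSquareField hf hg,
    fun p F hF f hf => H.tendsto_functional_calculus hF hf hlocal⟩
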